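/- Let $K$ be a number field and let $f \in K[X]$ be a monic polynomial of degree $d \ge 2$. Let $\Psi \in \frac1X K[[X]]$ be the unique Laurent series with $\Psi(X) = \frac1X + O(1)$ and $\Psi(X^d) = f(\Psi(X))$ (the inverse of the Böttcher coordinate of $f$). Let $v$ be a non-archimedean place of $K$, let $K_v$ be the completion of $K$ at $v$ and $\overline{K}_v$ its algebraic closure, with the unique extension $|\cdot|_v$ of the $v$-adic absolute value. Let $R \in (0,\infty]$ be maximal such that $\Psi$ converges on $$\Delta^* = \{z \in \overline{K}_v : 0 < |z|_v < R\}.$$ Let $P \in K[X,Y]\setminus\{0\}$ be absolutely irreducible, let $(k_1,k_2) \in \mathbb{Z}^2\setminus\{(0,0)\}$, let $\zeta_1,\zeta_2 \in \overline{K}_v$ be roots of unity, and let $a \in \Delta^*$ be transcendental over $\mathbb{Q}$ and such that some $d$-th root $a^{1/d}$ of $a$ lies in $\Delta^*$. Suppose that $$P\bigl(1/\Psi(\zeta_1 a x^{k_1}),\, 1/\Psi(\zeta_2 a x^{k_2})\bigr) = 0$$ for all $x \in \overline{K}_v$ with $a x^{k_1} \in \Delta^*$ and $a x^{k_2} \in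 \Delta^*$ at which both values of $\Psi$ are non-zero. Then $k_1 k_2 (k_1 - k_2) = 0$. -/

import Mathlib

open Polynomial IsDedekindDomain NumberField
open scoped ENNReal

noncomputable section

namespace Bottcher

section FormalSeries

variable {F : Type*} [Field F]

/-- The substitution `X ↦ X ^ d` on Laurent series, for `d > 0`. -/
def laurentExpand (d : ℕ) (hd : 0 < d) : LaurentSeries F →+* LaurentSeries F :=
  HahnSeries.embDomainRingHom (AddMonoidHom.mulLeft (d : ℤ))
    (fun _ _ h => mul_left_cancel₀ (by exact_mod_cast hd.ne') h)
    (fun _ _ => mul_le_mul_iff_right₀ (by exact_mod_cast hd))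

/-- `Ψ ∈ X⁻¹ F⟦X⟧` has a simple pole of residue `1` at `0` and satisfies
`Ψ(X ^ d) = f(Ψ(X))`, where `d` is the degree of `f`. -/
structure IsBottcherInverse (f : F[X]) (hd : 0 < f.natDegree) (Ψ : LaurentSeries F) : Prop where
  coeff_of_lt : ∀ n : ℤ, n < -1 → Ψ.coeff n = 0
  residue : Ψ.coeff (-1) = 1
  mahler : laurentExpand f.natDegree hd Ψ = f.eval₂ HahnSeries.C Ψ

/-- `X ^ d * f(X⁻¹ g) - g(X ^ d)`, written with power series. -/
def defect (f : F[X]) (hd : f.natDegree ≠ 0) (g : PowerSeries F) : PowerSeries F :=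
  ∑ i ∈ Finset.range (f.natDegree + 1),
    PowerSeries.C (f.coeff i) * PowerSeries.X ^ (f.natDegree - i) * g ^ i
    - PowerSeries.expand f.natDegree hd g

lemma coeff_zero_defect (f : F[X]) (hf : f.Monic) (hd : f.natDegree ≠ 0) (g : PowerSeries F)
    (hg : PowerSeries.constantCoeff g = 1) : PowerSeries.coeff 0 (defect f hd g) = 0 := by
  rw [PowerSeries.coeff_zero_eq_constantCoeff_apply]
  simp only [defect, map_sub, map_sum, map_mul, map_pow, PowerSeries.constantCoeff_expand, hg,
    PowerSeries.constantCoeff_X, PowerSeries.constantCoeff_C]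
  rw [Finset.sum_range_succ, Finset.sum_eq_zero]
  · simp [hf.coeff_natDegree]
  · intro i hi
    have : f.natDegree - i ≠ 0 := by have := Finset.mem_range.1 hi; omega
    simp [this]

lemma coeff_defect_sub (f : F[X]) (hf : f.Monic) (hd : 2 ≤ f.natDegree) (hd' : f.natDegree ≠ 0)
    (g h : PowerSeries F)
    (hg : PowerSeries.constantCoeff g = 1) (hh : PowerSeries.constantCoeff h = 1) (m : ℕ)
    (hm : 1 ≤ m) (hgh : PowerSeries.X ^ m ∣ g - h) :
    PowerSeries.coeff m (defect f hd' g) - PowerSeries.coeff m (defect f hd' h)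
      = f.natDegree * (PowerSeries.coeff m g - PowerSeries.coeff m h) := by
  obtain ⟨u, hu⟩ := hgh
  have key : ∀ w : PowerSeries F, PowerSeries.X ^ (m + 1) ∣ w → PowerSeries.coeff m w = 0 :=
    fun w hw => PowerSeries.X_pow_dvd_iff.1 hw m (Nat.lt_succ_self m)
  have hX : ∀ w : PowerSeries F,
      PowerSeries.coeff m (PowerSeries.X ^ m * w) = PowerSeries.constantCoeff w := by
    intro w
    have := PowerSeries.coeff_X_pow_mul w m 0
    simpa using this
  have hcu : PowerSeries.coeff m g - PowerSeries.coeff m h = PowerSeries.constantCoeff u := by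
    rw [← map_sub, hu, hX]
  have hpow : ∀ i, g ^ i - h ^ i
      = PowerSeries.X ^ m * (u * ∑ j ∈ Finset.range i, g ^ j * h ^ (i - 1 - j)) := by
    intro i
    rw [← mul_assoc, ← hu, mul_comm, Commute.geom_sum₂_mul (Commute.all g h)]
  have hexp : PowerSeries.coeff m (PowerSeries.expand f.natDegree hd' g)
      - PowerSeries.coeff m (PowerSeries.expand f.natDegree hd' h) = 0 := by
    rw [← map_sub, ← map_sub, hu]
    apply key
    rw [map_mul, map_pow, PowerSeries.expand_X, ← pow_mul]
    exact Dvd.dvd.mul_right (pow_dvd_pow _ (by nlinarith)) _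
  have hsum : defect f hd' g - defect f hd' h
      = ∑ i ∈ Finset.range (f.natDegree + 1),
          PowerSeries.C (f.coeff i) * PowerSeries.X ^ (f.natDegree - i) * (g ^ i - h ^ i)
        - (PowerSeries.expand f.natDegree hd' g - PowerSeries.expand f.natDegree hd' h) := by
    simp only [defect, mul_sub, Finset.sum_sub_distrib]
    ring
  rw [← map_sub, hsum, map_sub, map_sub, hexp, sub_zero, Finset.sum_range_succ, map_add, map_sum,
    Finset.sum_eq_zero, zero_add, hcu]
  · rw [hpow, hf.coeff_natDegree]
    simp only [map_one, Nat.sub_self, pow_zero, one_mul]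
    rw [hX]
    simp [hg, hh, mul_comm]
  · intro i hi
    apply key
    rw [hpow]
    have : f.natDegree - i = (f.natDegree - i - 1) + 1 := by
      have := Finset.mem_range.1 hi; omega
    rw [this]
    refine ⟨PowerSeries.C (f.coeff i) * PowerSeries.X ^ (f.natDegree - i - 1) *
      (u * ∑ j ∈ Finset.range i, g ^ j * h ^ (i - 1 - j)), ?_⟩
    ring

/-- Successive approximations to the solution of `defect f g = 0` with constant term `1`. -/
def approx (f : F[X]) (hd : f.natDegree ≠ 0) : ℕ → PowerSeries F
  | 0 => 1
  | n + 1 => approx f hd n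
      - PowerSeries.C (PowerSeries.coeff (n + 1) (defect f hd (approx f hd n)) / f.natDegree)
        * PowerSeries.X ^ (n + 1)

lemma exists_defect_eq_zero [CharZero F] (f : F[X]) (hf : f.Monic) (hd : 2 ≤ f.natDegree)
    (hd' : f.natDegree ≠ 0) :
    ∃ g : PowerSeries F, PowerSeries.constantCoeff g = 1 ∧ defect f hd' g = 0 := by
  have hdF : (f.natDegree : F) ≠ 0 := by exact_mod_cast hd'
  have h1 : ∀ n, PowerSeries.constantCoeff (approx f hd' n) = 1 := by
    intro n
    induction n with
    | zero => simp [approx]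
    | succ n ih => simp [approx, ih]
  have hstep : ∀ n, PowerSeries.X ^ (n + 1) ∣ approx f hd' (n + 1) - approx f hd' n := by
    intro n
    refine ⟨-PowerSeries.C
      (PowerSeries.coeff (n + 1) (defect f hd' (approx f hd' n)) / f.natDegree), ?_⟩
    simp only [approx]
    ring
  have hle : ∀ n k, PowerSeries.X ^ (n + 1) ∣ approx f hd' (n + k) - approx f hd' n := by
    intro n k
    induction k with
    | zero => simp
    | succ k ih =>
      have h2 := dvd_add ((pow_dvd_pow PowerSeries.X (by omega : n + 1 ≤ n + k + 1)).trans
        (hstep (n + k))) ih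
      rwa [sub_add_sub_cancel] at h2
  have hzero : ∀ n k, k ≤ n → PowerSeries.coeff k (defect f hd' (approx f hd' n)) = 0 := by
    intro n
    induction n with
    | zero =>
      intro k hk
      obtain rfl : k = 0 := by omega
      exact coeff_zero_defect f hf hd' _ (h1 0)
    | succ n ih =>
      intro k hk
      rcases Nat.eq_zero_or_pos k with rfl | hk0
      · exact coeff_zero_defect f hf hd' _ (h1 _)
      have h2 := coeff_defect_sub f hf hd hd' (approx f hd' (n + 1)) (approx f hd' n) (h1 _) (h1 _)
        k hk0 ((pow_dvd_pow _ hk).trans (hstep n))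
      rcases Nat.lt_or_ge k (n + 1) with hlt | hge
      · have h3 := PowerSeries.X_pow_dvd_iff.1 (hstep n) k hlt
        rw [map_sub] at h3
        rw [h3, mul_zero, ih k (by omega), sub_zero] at h2
        exact h2
      · obtain rfl : k = n + 1 := by omega
        have h4 : PowerSeries.coeff (n + 1) (approx f hd' (n + 1))
            - PowerSeries.coeff (n + 1) (approx f hd' n)
            = - (PowerSeries.coeff (n + 1) (defect f hd' (approx f hd' n)) / f.natDegree) := by
          simp [approx]
        rw [h4] at h2
        have h5 : (f.natDegree : F) *
            -(PowerSeries.coeff (n + 1) (defect f hd' (approx f hd' n)) / f.natDegree)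
            = - PowerSeries.coeff (n + 1) (defect f hd' (approx f hd' n)) := by
          field_simp
        rw [h5] at h2
        linear_combination h2
  refine ⟨PowerSeries.mk fun n => PowerSeries.coeff n (approx f hd' n), ?_, ?_⟩
  · rw [← PowerSeries.coeff_zero_eq_constantCoeff_apply, PowerSeries.coeff_mk,
      PowerSeries.coeff_zero_eq_constantCoeff_apply, h1]
  · have hg1 : PowerSeries.constantCoeff
        (PowerSeries.mk fun n => PowerSeries.coeff n (approx f hd' n)) = 1 := by
      rw [← PowerSeries.coeff_zero_eq_constantCoeff_apply, PowerSeries.coeff_mk,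
        PowerSeries.coeff_zero_eq_constantCoeff_apply, h1]
    ext n
    rw [map_zero]
    rcases Nat.eq_zero_or_pos n with rfl | hn0
    · exact coeff_zero_defect f hf hd' _ hg1
    have hdvd : PowerSeries.X ^ (n + 1) ∣
        (PowerSeries.mk fun n => PowerSeries.coeff n (approx f hd' n)) - approx f hd' n := by
      rw [PowerSeries.X_pow_dvd_iff]
      intro k hk
      obtain ⟨j, rfl⟩ := Nat.exists_eq_add_of_le (Nat.lt_succ_iff.1 hk)
      have h3 := PowerSeries.X_pow_dvd_iff.1 (hle k j) k (Nat.lt_succ_self k)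
      rw [map_sub] at h3 ⊢
      rw [PowerSeries.coeff_mk]
      linear_combination -h3
    have h2 := coeff_defect_sub f hf hd hd' _ (approx f hd' n) hg1 (h1 n) n hn0
      ((pow_dvd_pow _ (Nat.le_succ n)).trans hdvd)
    have h3 := PowerSeries.X_pow_dvd_iff.1 hdvd n (Nat.lt_succ_self n)
    rw [map_sub] at h3
    rw [h3, mul_zero, hzero n n le_rfl, sub_zero] at h2
    exact h2

lemma eq_of_defect_eq_zero [CharZero F] (f : F[X]) (hf : f.Monic) (hd : 2 ≤ f.natDegree)
    (hd' : f.natDegree ≠ 0) (g h : PowerSeries F)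
    (hg : PowerSeries.constantCoeff g = 1) (hh : PowerSeries.constantCoeff h = 1)
    (hg0 : defect f hd' g = 0) (hh0 : defect f hd' h = 0) : g = h := by
  have hdF : (f.natDegree : F) ≠ 0 := by exact_mod_cast hd'
  have : ∀ n, PowerSeries.X ^ (n + 1) ∣ g - h := by
    intro n
    induction n with
    | zero =>
      rw [zero_add, pow_one, PowerSeries.X_dvd_iff, map_sub, hg, hh, sub_self]
    | succ n ih =>
      have h2 := coeff_defect_sub f hf hd hd' g h hg hh (n + 1) (by omega) ih
      rw [hg0, hh0, sub_self, eq_comm, mul_eq_zero, or_iff_right hdF, ← map_sub] at h2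
      rw [PowerSeries.X_pow_dvd_iff] at ih ⊢
      intro k hk
      rcases Nat.lt_or_ge k (n + 1) with hlt | hge
      · exact ih k hlt
      · obtain rfl : k = n + 1 := by omega
        exact h2
  ext n
  have h3 := PowerSeries.X_pow_dvd_iff.1 (this n) n (Nat.lt_succ_self n)
  rw [map_sub] at h3
  exact sub_eq_zero.1 h3

lemma laurentExpand_coeff_mul (d : ℕ) (hd : 0 < d) (Ψ : LaurentSeries F) (n : ℤ) :
    (laurentExpand d hd Ψ).coeff (d * n) = Ψ.coeff n :=
  HahnSeries.embDomain_coeff (f := ⟨⟨fun n : ℤ => (d : ℤ) * n, _⟩, _⟩)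

lemma laurentExpand_coeff_of_not_dvd (d : ℕ) (hd : 0 < d) (Ψ : LaurentSeries F) (n : ℤ)
    (h : ¬ (d : ℤ) ∣ n) : (laurentExpand d hd Ψ).coeff n = 0 :=
  HahnSeries.embDomain_of_notMem_range (f := ⟨⟨fun n : ℤ => (d : ℤ) * n, _⟩, _⟩)
    (by rintro ⟨m, rfl⟩; exact h ⟨m, rfl⟩)

lemma laurentExpand_single (d : ℕ) (hd : 0 < d) (n : ℤ) (r : F) :
    laurentExpand d hd (HahnSeries.single n r) = HahnSeries.single (d * n) r :=
  HahnSeries.embDomain_single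

lemma laurentExpand_coe (d : ℕ) (hd : 0 < d) (g : PowerSeries F) :
    laurentExpand d hd (g : LaurentSeries F) = (PowerSeries.expand d hd.ne' g : PowerSeries F) := by
  ext n
  by_cases h : (d : ℤ) ∣ n
  · obtain ⟨m, rfl⟩ := h
    rw [laurentExpand_coeff_mul]
    rcases lt_or_ge m 0 with hm | hm
    · rw [PowerSeries.coeff_coe, PowerSeries.coeff_coe, if_pos hm, if_pos]
      exact mul_neg_of_pos_of_neg (by exact_mod_cast hd) hm
    · obtain ⟨k, rfl⟩ := Int.eq_ofNat_of_zero_le hm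
      rw [← Nat.cast_mul]
      rw [LaurentSeries.coeff_coe_powerSeries, LaurentSeries.coeff_coe_powerSeries,
        PowerSeries.coeff_expand_mul]
  · rw [laurentExpand_coeff_of_not_dvd _ _ _ _ h, PowerSeries.coeff_coe]
    split_ifs with hn
    · rfl
    · rw [PowerSeries.coeff_expand_of_not_dvd]
      rintro ⟨k, hk⟩
      exact h ⟨k, by omega⟩

lemma single_mul_defect (f : F[X]) (hd : 0 < f.natDegree) (g : PowerSeries F) :
    HahnSeries.single (-(f.natDegree : ℤ)) (1 : F) * (defect f hd.ne' g : PowerSeries F)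
      = f.eval₂ HahnSeries.C (HahnSeries.single (-1 : ℤ) (1 : F) * (g : LaurentSeries F))
        - laurentExpand f.natDegree hd (HahnSeries.single (-1 : ℤ) (1 : F) * (g : LaurentSeries F)) := by
  rw [map_mul, laurentExpand_single, laurentExpand_coe, eval₂_eq_sum_range, defect,
    map_sub, mul_sub, map_sum, Finset.mul_sum, mul_neg, mul_one]
  congr 1
  refine Finset.sum_congr rfl fun i hi => ?_
  have hi' : i ≤ f.natDegree := Nat.lt_succ_iff.1 (Finset.mem_range.1 hi)
  rw [map_mul, map_mul, map_pow, mul_pow, map_pow, PowerSeries.coe_C, PowerSeries.coe_X,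
    HahnSeries.single_pow, HahnSeries.single_pow, one_pow, one_pow]
  have : HahnSeries.single (-(f.natDegree : ℤ)) (1 : F)
      * HahnSeries.single ((f.natDegree - i : ℕ) • (1 : ℤ)) (1 : F)
      = HahnSeries.single (i • (-1 : ℤ)) (1 : F) := by
    rw [HahnSeries.single_mul_single, mul_one]
    congr 1
    simp only [nsmul_eq_mul]
    push_cast [hi']
    ring_nf
  rw [← this]
  ring

lemma isBottcherInverse_iff (f : F[X]) (hd : 0 < f.natDegree) (g : PowerSeries F) :
    IsBottcherInverse f hd (HahnSeries.single (-1 : ℤ) (1 : F) * (g : LaurentSeries F)) ↔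
      PowerSeries.constantCoeff g = 1 ∧ defect f hd.ne' g = 0 := by
  have hc : ∀ n : ℤ, (HahnSeries.single (-1 : ℤ) (1 : F) * (g : LaurentSeries F)).coeff n
      = (g : LaurentSeries F).coeff (n + 1) := by
    intro n
    have := HahnSeries.coeff_single_mul_add (r := (1 : F)) (x := (g : LaurentSeries F))
      (a := n + 1) (b := -1)
    rw [one_mul] at this
    rw [← this]
    congr 1
    ring
  have hz : f.eval₂ HahnSeries.C (HahnSeries.single (-1 : ℤ) (1 : F) * (g : LaurentSeries F))
        - laurentExpand f.natDegree hd (HahnSeries.single (-1 : ℤ) (1 : F) * (g : LaurentSeries F))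
        = 0 ↔ defect f hd.ne' g = 0 := by
    rw [← single_mul_defect, mul_eq_zero, or_iff_right
      (HahnSeries.single_ne_zero one_ne_zero)]
    exact map_eq_zero_iff _ HahnSeries.ofPowerSeries_injective
  have h0 : (g : LaurentSeries F).coeff (-1 + 1) = PowerSeries.constantCoeff g := by
    have := LaurentSeries.coeff_coe_powerSeries g 0
    simpa using this
  constructor
  · rintro ⟨-, h2, h3⟩
    exact ⟨by rw [← h0, ← hc, h2], hz.1 (sub_eq_zero.2 h3.symm)⟩
  · rintro ⟨h1, h2⟩
    refine ⟨fun n hn => ?_, by rw [hc, h0, h1], (sub_eq_zero.1 (hz.2 h2)).symm⟩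
    rw [hc, PowerSeries.coeff_coe, if_pos (by omega)]

/-- Existence and uniqueness of the inverse of the Böttcher coordinate. -/
theorem existsUnique_isBottcherInverse [CharZero F] (f : F[X]) (hf : f.Monic)
    (hd : 2 ≤ f.natDegree) : ∃! Ψ : LaurentSeries F,
      IsBottcherInverse f (lt_of_lt_of_le two_pos hd) Ψ := by
  have hd0 : 0 < f.natDegree := lt_of_lt_of_le two_pos hd
  have hrep : ∀ Ψ : LaurentSeries F, IsBottcherInverse f hd0 Ψ → ∃ g : PowerSeries F,
      Ψ = HahnSeries.single (-1 : ℤ) (1 : F) * (g : LaurentSeries F) := by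
    intro Ψ hΨ
    refine ⟨PowerSeries.mk fun n => Ψ.coeff ((n : ℤ) - 1), ?_⟩
    ext n
    have := HahnSeries.coeff_single_mul_add (r := (1 : F))
      (x := ((PowerSeries.mk fun n => Ψ.coeff ((n : ℤ) - 1) : PowerSeries F) : LaurentSeries F))
      (a := n + 1) (b := -1)
    rw [one_mul, show n + 1 + -1 = n by ring] at this
    rw [this, PowerSeries.coeff_coe]
    split_ifs with h
    · exact hΨ.coeff_of_lt n (by omega)
    · rw [PowerSeries.coeff_mk]
      congr 1
      omega
  obtain ⟨g, hg1, hg0⟩ := exists_defect_eq_zero f hf hd hd0.ne'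
  refine ⟨_, (isBottcherInverse_iff f hd0 g).2 ⟨hg1, hg0⟩, ?_⟩
  intro Ψ hΨ
  obtain ⟨h, rfl⟩ := hrep Ψ hΨ
  obtain ⟨hh1, hh0⟩ := (isBottcherInverse_iff f hd0 h).1 hΨ
  rw [eq_of_defect_eq_zero f hf hd hd0.ne' h g hh1 hg1 hh0 hg0]

/-- The unique Laurent series `Ψ ∈ X⁻¹ F⟦X⟧` with residue `1` and `Ψ(X ^ d) = f(Ψ(X))`, for a
monic polynomial `f` of degree `d ≥ 2` over a field of characteristic zero. -/
def bottcherInverse [CharZero F] (f : F[X]) (hf : f.Monic) (hd : 2 ≤ f.natDegree) :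
    LaurentSeries F :=
  (existsUnique_isBottcherInverse f hf hd).choose

end FormalSeries

section Place

variable (K : Type*) [Field K] [NumberField K] (v : HeightOneSpectrum (𝓞 K))

/-- The algebraic closure of the completion of the number field `K` at the finite place `v`. -/
abbrev AdicAlgCl : Type _ := AlgebraicClosure (v.adicCompletion K)

instance : CharZero (v.adicCompletion K) :=
  charZero_of_injective_algebraMap (algebraMap K (v.adicCompletion K)).injective

instance : CharZero (AdicAlgCl K v) :=
  charZero_of_injective_algebraMap
    (algebraMap (v.adicCompletion K) (AdicAlgCl K v)).injective

instance : NontriviallyNormedField (v.adicCompletion K) :=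
  Valued.toNontriviallyNormedField (v.adicCompletion K) (WithZero (Multiplicative ℤ))

/-- The unique extension of the `v`-adic absolute value to the algebraic closure. -/
instance : NormedField (AdicAlgCl K v) :=
  spectralNorm.normedField (v.adicCompletion K) (AdicAlgCl K v)

variable {K}

/-- The terms of the Laurent series `Ψ` at the point `z`. -/
def laurentTerm (Ψ : LaurentSeries K) (z : AdicAlgCl K v) (n : ℤ) : AdicAlgCl K v :=
  algebraMap K (AdicAlgCl K v) (Ψ.coeff n) * z ^ n

/-- The value at `z` of the function defined by the Laurent series `Ψ`. -/
def laurentEval (Ψ : LaurentSeries K) (z : AdicAlgCl K v) : AdicAlgCl K v :=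
  ∑' n : ℤ, laurentTerm v Ψ z n

/-- The largest `R ∈ [0, ∞]` such that `Ψ` converges at all `z` with `0 < |z| < R`. -/
def convergenceRadius (Ψ : LaurentSeries K) : ℝ≥0∞ :=
  sSup {r : ℝ≥0∞ | ∀ z : AdicAlgCl K v, z ≠ 0 → ‖z‖ₑ < r → Summable (laurentTerm v Ψ z)}

/-- The punctured disc `0 < |z| < R`, with `R` the radius of convergence of `Ψ`. -/
def puncturedDisc (Ψ : LaurentSeries K) : Set (AdicAlgCl K v) :=
  {z | z ≠ 0 ∧ ‖z‖ₑ < convergenceRadius v Ψ}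

end Place

end Bottcher

end

noncomputable section

namespace Bottcher

/-! ### The norm on the algebraic closure and the convergence of `X * Ψ` -/

section Place
variable (K : Type*) [Field K] [NumberField K] (v : HeightOneSpectrum (𝓞 K))

/-! Write `Ψ(z) = g(z)/z` with `g` a power series and `g(0) = 1`, and suppose that `k₁`, `k₂` and
`k₁ - k₂` are all non-zero. The contradiction is one of transcendence degree. As `K` is countable
and the unit circle is not, some `y` with `|y| = 1` is transcendental over `K(a)`. Then `ζ₁ a y^k₁`
and `ζ₂ a y^k₂` are algebraically independent over `K`. If each is algebraic over the field
generated by its value under `Ψ`, the two values cannot satisfy a polynomial relation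
(`false_of_relation`). What remains is to show that `Ψ` is algebraic.

If `|a| ≥ 1`, the radius of convergence exceeds `1`. Iterating the functional equation spreads a
coefficient bound from radius `ρ` to `ρ^(d^k)`, which forces `g` to be a polynomial
(`exists_eq_polynomial_of_one_lt`).

If `|a| < 1`, the functional equation carries the relation at `a` to relations at `a^(d^m)`. After
one such move `Ψ` is injective on the circle through the new base point `b`. A dimension count then
bounds the degree of the relation at `b^(d^m)` by some `D` independent of `m`
(`exists_relation_of_fibres`, `RegularEval.hasRelation_pow_of_injOnCircle`). Determinants formed
from the monomials of degree at most `D` are power series vanishing at points tending to `0`, hence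
identically. This gives a linear relation over `E⟦X⟧` between the products `p_i(η₁ y^k₁ X) p_j(η₂
y^k₂ X)`, with `p_i = X^(D-i) g^i`, valid for all `|y| = 1`. Comparing powers of `y` shows that it
is trivial unless the `p_i` are dependent over `K[X]` (`eq_zero_of_forall_rescale`). So they are
dependent, and `g` is algebraic. -/

instance isUltrametricDist_adicAlgCl : IsUltrametricDist (AdicAlgCl K v) :=
  IsUltrametricDist.isUltrametricDist_of_isNonarchimedean_norm
    (isNonarchimedean_spectralNorm (K := v.adicCompletion K) (L := AdicAlgCl K v))

lemma norm_algebraMap_adicAlgCl (x : v.adicCompletion K) :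
    ‖algebraMap (v.adicCompletion K) (AdicAlgCl K v) x‖ = ‖x‖ :=
  spectralNorm_extends x

lemma exists_one_lt_norm : ∃ ϖ : AdicAlgCl K v, 1 < ‖ϖ‖ := by
  obtain ⟨x, hx⟩ := NormedField.exists_one_lt_norm (v.adicCompletion K)
  exact ⟨_, by rwa [norm_algebraMap_adicAlgCl]⟩

/-- The circle already contains a non-empty open subset of the complete field `K_v`, which has at
least the cardinality of the continuum. -/
lemma not_countable_unit_circle : ¬ {y : AdicAlgCl K v | ‖y‖ = 1}.Countable := by
  intro h
  have h1 : {y : v.adicCompletion K | ‖y‖ = 1}.Countable := by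
    have := h.preimage (algebraMap (v.adicCompletion K) (AdicAlgCl K v)).injective
    convert this using 1
    ext y
    simp [norm_algebraMap_adicAlgCl]
  have h2 : IsOpen {y : v.adicCompletion K | ‖y‖ = 1} := by
    have := IsUltrametricDist.isOpen_sphere (0 : v.adicCompletion K) (r := 1) one_ne_zero
    convert this using 1
    ext y
    simp
  have h3 := continuum_le_cardinal_of_isOpen (v.adicCompletion K) h2 ⟨1, by simp⟩
  exact absurd (h3.trans h1.le_aleph0) (not_le.2 Cardinal.aleph0_lt_continuum)

lemma countable_numberField (K : Type*) [Field K] [NumberField K] : Countable K := by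
  have h := Algebraic.countable ℚ K
  have : {x : K | IsAlgebraic ℚ x} = Set.univ :=
    Set.eq_univ_of_forall fun x => Algebra.IsAlgebraic.isAlgebraic x
  rw [this] at h
  exact Set.countable_univ_iff.1 h

/-- An `n`-th root of an element of norm greater than `1` has norm greater than `1` and, for large
`n`, as close to `1` as needed. -/
lemma exists_norm_lt_and_lt {z : AdicAlgCl K v} (hz : z ≠ 0) {r : ℝ≥0∞} (hr : ‖z‖ₑ < r) :
    ∃ z' : AdicAlgCl K v, ‖z‖ < ‖z'‖ ∧ ‖z'‖ₑ < r := by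
  obtain ⟨ϖ, hϖ⟩ := exists_one_lt_norm K v
  have hz0 : 0 < ‖z‖ := norm_pos_iff.2 hz
  obtain ⟨t, ht1, ht2⟩ := ENNReal.lt_iff_exists_real_btwn.1 hr
  have hzt : ‖z‖ < t := by
    rw [← ofReal_norm] at ht2
    exact (ENNReal.ofReal_lt_ofReal_iff_of_nonneg hz0.le).1 ht2.1
  obtain ⟨n, hn⟩ := pow_unbounded_of_one_lt ‖ϖ‖ ((one_lt_div hz0).2 hzt)
  have hn0 : n ≠ 0 := by
    rintro rfl
    simp at hn
    linarith
  obtain ⟨y, hy⟩ := IsAlgClosed.exists_pow_nat_eq ϖ (Nat.pos_of_ne_zero hn0)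
  have hyn : ‖y‖ ^ n = ‖ϖ‖ := by rw [← norm_pow, hy]
  have hy1 : 1 < ‖y‖ := by
    by_contra h
    have := pow_le_one₀ (n := n) (norm_nonneg y) (not_lt.1 h)
    linarith
  have hy2 : ‖y‖ < t / ‖z‖ := by
    by_contra h
    have := pow_le_pow_left₀ (by positivity) (not_lt.1 h) n
    linarith
  refine ⟨z * y, ?_, ?_⟩
  · rw [norm_mul]
    nlinarith
  · refine lt_trans ?_ ht2.2
    rw [← ofReal_norm, norm_mul]
    refine (ENNReal.ofReal_lt_ofReal_iff (hz0.trans hzt)).2 ?_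
    rw [lt_div_iff₀ hz0] at hy2
    linarith

variable {K}

lemma summable_laurentTerm {Ψ : LaurentSeries K} {z : AdicAlgCl K v}
    (hz : z ∈ puncturedDisc v Ψ) : Summable (laurentTerm v Ψ z) := by
  obtain ⟨r, hr, hzr⟩ := lt_sSup_iff.1 hz.2
  exact hr z hz.1 hzr

lemma mem_puncturedDisc_of_norm_le {Ψ : LaurentSeries K} {z z' : AdicAlgCl K v}
    (hz : z ∈ puncturedDisc v Ψ) (hz' : z' ≠ 0) (h : ‖z'‖ ≤ ‖z‖) : z' ∈ puncturedDisc v Ψ := by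
  refine ⟨hz', lt_of_le_of_lt ?_ hz.2⟩
  rw [← ofReal_norm, ← ofReal_norm]
  exact ENNReal.ofReal_le_ofReal h

lemma exists_mem_puncturedDisc_norm_lt {Ψ : LaurentSeries K} {z : AdicAlgCl K v}
    (hz : z ∈ puncturedDisc v Ψ) : ∃ z' ∈ puncturedDisc v Ψ, ‖z‖ < ‖z'‖ := by
  obtain ⟨z', h1, h2⟩ := exists_norm_lt_and_lt K v hz.1 hz.2
  exact ⟨z', ⟨norm_pos_iff.1 ((norm_nonneg z).trans_lt h1), h2⟩, h1⟩

/-- The regular part `X * Ψ` of the inverse of the Böttcher coordinate. -/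
lemma exists_powerSeries_bottcherInverse {F : Type*} [Field F] [CharZero F] (f : F[X])
    (hf : f.Monic) (hd : 2 ≤ f.natDegree) :
    ∃ g : PowerSeries F, PowerSeries.constantCoeff g = 1 ∧ defect f (by omega) g = 0 ∧
      (∀ n : ℕ, (bottcherInverse f hf hd).coeff ((n : ℤ) - 1) = PowerSeries.coeff n g) ∧
      ∀ n : ℤ, n < -1 → (bottcherInverse f hf hd).coeff n = 0 := by
  obtain ⟨g, hg1, hg0⟩ := exists_defect_eq_zero f hf hd (by omega)
  have hb := (existsUnique_isBottcherInverse f hf hd).choose_spec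
  have heq : HahnSeries.single (-1 : ℤ) (1 : F) * (g : LaurentSeries F)
      = bottcherInverse f hf hd :=
    hb.2 _ ((isBottcherInverse_iff f (by omega) g).2 ⟨hg1, hg0⟩)
  refine ⟨g, hg1, hg0, fun n => ?_, hb.1.coeff_of_lt⟩
  rw [← heq, sub_eq_add_neg, HahnSeries.coeff_single_mul_add, one_mul,
    LaurentSeries.coeff_coe_powerSeries]

/-- The terms are bounded at a point of slightly larger norm, so at `z` they are dominated by a
geometric series. -/
lemma summable_norm_regularPart {Ψ : LaurentSeries K} {g : PowerSeries K}
    (hg : ∀ n : ℕ, Ψ.coeff ((n : ℤ) - 1) = PowerSeries.coeff n g) {z : AdicAlgCl K v}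
    (hz : z ∈ puncturedDisc v Ψ) :
    Summable fun n : ℕ => ‖algebraMap K (AdicAlgCl K v) (PowerSeries.coeff n g)‖ * ‖z‖ ^ n := by
  obtain ⟨z', hz', hlt⟩ := exists_mem_puncturedDisc_norm_lt v hz
  have hz'0 : 0 < ‖z'‖ := norm_pos_iff.2 hz'.1
  have h1 : Filter.Tendsto (fun n : ℕ => laurentTerm v Ψ z' ((n : ℤ) - 1)) Filter.atTop (nhds 0) := by
    have hinj : Function.Injective fun n : ℕ => (n : ℤ) - 1 := fun a b h => by simpa using h
    rw [← Nat.cofinite_eq_atTop]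
    exact (summable_laurentTerm v hz').tendsto_cofinite_zero.comp hinj.tendsto_cofinite
  obtain ⟨C, hC⟩ := h1.norm.bddAbove_range
  have hC' : ∀ n : ℕ, ‖algebraMap K (AdicAlgCl K v) (PowerSeries.coeff n g)‖ * ‖z'‖ ^ n
      ≤ C * ‖z'‖ := by
    intro n
    have := hC ⟨n, rfl⟩
    simp only [laurentTerm, hg, norm_mul, norm_zpow] at this
    rw [zpow_sub_one₀ hz'0.ne', zpow_natCast, ← mul_assoc, mul_inv_le_iff₀ hz'0] at this
    exact this
  refine Summable.of_nonneg_of_le (fun n => by positivity) (fun n => ?_)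
    ((summable_geometric_of_lt_one (r := ‖z‖ / ‖z'‖) (by positivity)
      ((div_lt_one hz'0).2 hlt)).mul_left (C * ‖z'‖))
  rw [div_pow, mul_div_assoc', le_div_iff₀ (by positivity)]
  calc _ = (‖algebraMap K (AdicAlgCl K v) (PowerSeries.coeff n g)‖ * ‖z'‖ ^ n) * ‖z‖ ^ n := by ring
    _ ≤ _ := mul_le_mul_of_nonneg_right (hC' n) (by positivity)

lemma hasSum_regularPart {Ψ : LaurentSeries K} {g : PowerSeries K}
    (hg : ∀ n : ℕ, Ψ.coeff ((n : ℤ) - 1) = PowerSeries.coeff n g)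
    (h0 : ∀ n : ℤ, n < -1 → Ψ.coeff n = 0) {z : AdicAlgCl K v} (hz : z ∈ puncturedDisc v Ψ) :
    HasSum (fun n : ℕ => algebraMap K (AdicAlgCl K v) (PowerSeries.coeff n g) * z ^ n)
      (z * laurentEval v Ψ z) := by
  have h1 : HasSum (laurentTerm v Ψ z) (laurentEval v Ψ z) := (summable_laurentTerm v hz).hasSum
  have hinj : Function.Injective fun n : ℕ => (n : ℤ) - 1 := fun a b h => by simpa using h
  rw [← hinj.hasSum_iff] at h1
  · have h2 : (fun n : ℕ => algebraMap K (AdicAlgCl K v) (PowerSeries.coeff n g) * z ^ n)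
        = fun n : ℕ => z * (laurentTerm v Ψ z ∘ fun n : ℕ => (n : ℤ) - 1) n := by
      funext n
      simp only [Function.comp, laurentTerm, hg]
      rw [zpow_sub_one₀ hz.1, zpow_natCast]
      field_simp [hz.1]
    rw [h2]
    exact h1.mul_left z
  · intro n hn
    have : n < -1 := by
      by_contra h
      exact hn ⟨(n + 1).toNat, by simp; omega⟩
    simp [laurentTerm, h0 n this]

end Place

/-! ### Evaluation of power series at a point -/

section Evaluation

variable {E : Type*} [NormedField E]

/-- The pairs `(p, s)` such that the power series `p` converges absolutely at `z` with sum `s`. -/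
def evalSubring (z : E) : Subring (PowerSeries E × E) where
  -- The field is not assumed complete, so absolute convergence does not imply convergence: the sum
  -- is carried along as the second component.
  carrier := {p | (Summable fun n => ‖PowerSeries.coeff n p.1‖ * ‖z‖ ^ n) ∧
    HasSum (fun n => PowerSeries.coeff n p.1 * z ^ n) p.2}
  mul_mem' := by
    rintro ⟨p, s⟩ ⟨q, t⟩ ⟨hp, hps⟩ ⟨hq, hqt⟩
    have hp' : Summable fun n => ‖PowerSeries.coeff n p * z ^ n‖ := by
      simpa [norm_mul, norm_pow] using hp
    have hq' : Summable fun n => ‖PowerSeries.coeff n q * z ^ n‖ := by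
      simpa [norm_mul, norm_pow] using hq
    have hterm : ∀ n, ∑ kl ∈ Finset.HasAntidiagonal.antidiagonal n,
        (PowerSeries.coeff kl.1 p * z ^ kl.1) * (PowerSeries.coeff kl.2 q * z ^ kl.2)
        = PowerSeries.coeff n (p * q) * z ^ n := by
      intro n
      rw [PowerSeries.coeff_mul, Finset.sum_mul]
      refine Finset.sum_congr rfl fun kl hkl => ?_
      rw [← Finset.HasAntidiagonal.mem_antidiagonal.1 hkl, pow_add]
      ring
    have h1 := summable_norm_sum_mul_antidiagonal_of_summable_norm hp' hq'
    have h2 := tsum_mul_tsum_eq_tsum_sum_antidiagonal_of_summable_norm' hp' hps.summable hq'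
      hqt.summable
    have h3 := summable_sum_mul_antidiagonal_of_summable_norm' hp' hps.summable hq' hqt.summable
    simp only [hterm] at h1 h2 h3
    refine ⟨by simpa [norm_mul, norm_pow] using h1, ?_⟩
    rw [hps.tsum_eq, hqt.tsum_eq] at h2
    show HasSum (fun n => PowerSeries.coeff n (p * q) * z ^ n) (s * t)
    rw [h2]
    exact h3.hasSum
  one_mem' := by
    constructor
    · refine summable_of_ne_finset_zero (s := {0}) fun n hn => ?_
      simp [PowerSeries.coeff_one, Finset.notMem_singleton.1 hn]
    · show HasSum (fun n => PowerSeries.coeff n (1 : PowerSeries E) * z ^ n) (1 : E)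
      convert hasSum_ite_eq 0 (1 : E) using 2 with n
      by_cases h : n = 0 <;> simp [PowerSeries.coeff_one, h]
  add_mem' := by
    rintro ⟨p, s⟩ ⟨q, t⟩ ⟨hp, hps⟩ ⟨hq, hqt⟩
    constructor
    · refine Summable.of_nonneg_of_le (fun n => by positivity) (fun n => ?_) (hp.add hq)
      show ‖PowerSeries.coeff n (p + q)‖ * ‖z‖ ^ n ≤ _
      rw [map_add, ← add_mul]
      exact mul_le_mul_of_nonneg_right (norm_add_le _ _) (by positivity)
    · simpa [add_mul] using hps.add hqt
  zero_mem' := by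
    constructor
    · simp [summable_zero]
    · simp [hasSum_zero]
  neg_mem' := by
    rintro ⟨p, s⟩ ⟨hp, hps⟩
    exact ⟨by simpa using hp, by simpa using hps.neg⟩

lemma mem_evalSubring {z : E} {p : PowerSeries E} {s : E} : (p, s) ∈ evalSubring z ↔
    (Summable fun n => ‖PowerSeries.coeff n p‖ * ‖z‖ ^ n) ∧
      HasSum (fun n => PowerSeries.coeff n p * z ^ n) s := Iff.rfl

lemma evalSubring_unique {z : E} {p : PowerSeries E} {s t : E} (hs : (p, s) ∈ evalSubring z)
    (ht : (p, t) ∈ evalSubring z) : s = t := hs.2.unique ht.2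

lemma polynomial_mem_evalSubring (z : E) (p : E[X]) :
    ((p : PowerSeries E), p.eval z) ∈ evalSubring z := by
  have h0 : ∀ n ∉ p.support, p.coeff n = 0 := fun n hn => Polynomial.notMem_support_iff.1 hn
  refine mem_evalSubring.2 ⟨summable_of_ne_finset_zero (s := p.support) fun n hn => ?_, ?_⟩
  · simp [Polynomial.coeff_coe, h0 n hn]
  · rw [Polynomial.eval_eq_sum, Polynomial.sum]
    simp only [Polynomial.coeff_coe]
    exact hasSum_sum_of_ne_finset_zero fun n hn => by simp [h0 n hn]

lemma C_mem_evalSubring (z c : E) : (PowerSeries.C c, c) ∈ evalSubring z := by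
  simpa using polynomial_mem_evalSubring z (Polynomial.C c)

lemma X_mem_evalSubring (z : E) : ((PowerSeries.X : PowerSeries E), z) ∈ evalSubring z := by
  simpa using polynomial_mem_evalSubring z (Polynomial.X)

lemma rescale_mem_evalSubring {b z : E} {p : PowerSeries E} {s : E}
    (h : (p, s) ∈ evalSubring (b * z)) : (PowerSeries.rescale b p, s) ∈ evalSubring z := by
  obtain ⟨h1, h2⟩ := mem_evalSubring.1 h
  refine mem_evalSubring.2 ⟨?_, ?_⟩
  · convert h1 using 2 with n
    rw [PowerSeries.coeff_rescale, norm_mul, norm_mul, norm_pow, mul_pow]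
    ring
  · convert h2 using 2 with n
    rw [PowerSeries.coeff_rescale, mul_pow]
    ring

lemma expand_mem_evalSubring {d : ℕ} (hd : d ≠ 0) {z : E} {p : PowerSeries E} {s : E}
    (h : (p, s) ∈ evalSubring (z ^ d)) : (PowerSeries.expand d hd p, s) ∈ evalSubring z := by
  obtain ⟨h1, h2⟩ := mem_evalSubring.1 h
  have hinj : Function.Injective fun n : ℕ => d * n := fun a b hab =>
    Nat.eq_of_mul_eq_mul_left (Nat.pos_of_ne_zero hd) hab
  have h0 : ∀ n ∉ Set.range (fun n : ℕ => d * n),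
      PowerSeries.coeff n (PowerSeries.expand d hd p) = 0 := fun n hn =>
    PowerSeries.coeff_expand_of_not_dvd _ _ _ fun ⟨m, hm⟩ => hn ⟨m, hm.symm⟩
  refine mem_evalSubring.2 ⟨?_, ?_⟩
  · rw [← hinj.summable_iff fun n hn => by rw [h0 n hn]; simp]
    convert h1 using 2 with n
    simp [PowerSeries.coeff_expand_mul, pow_mul]
  · rw [← hinj.hasSum_iff fun n hn => by rw [h0 n hn]; simp]
    convert h2 using 2 with n
    simp [PowerSeries.coeff_expand_mul, pow_mul]

/-- A power series with zeros accumulating at the origin vanishes. -/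
lemma eq_zero_of_accumulating_zeros {p : PowerSeries E}
    (h : ∀ ε > 0, ∃ c : E, c ≠ 0 ∧ ‖c‖ < ε ∧ (p, (0 : E)) ∈ evalSubring c) : p = 0 := by
  obtain ⟨c₀, hc₀, -, h₀⟩ := h 1 one_pos
  have hr : 0 < ‖c₀‖ := norm_pos_iff.2 hc₀
  have hs := (mem_evalSubring.1 h₀).1
  set S := ∑' n, ‖PowerSeries.coeff n p‖ * ‖c₀‖ ^ n
  have hS : 0 ≤ S := tsum_nonneg fun n => by positivity
  ext m
  rw [map_zero]
  induction m using Nat.strong_induction_on with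
  | _ m ih =>
  -- With the lower coefficients zero, a zero at `c` makes `p_m c^m` minus the tail of the series,
  -- which is at most `S (|c|/|c₀|)^(m+1)`. Letting `c` tend to `0` gives `p_m = 0`.
  have hbound : ∀ c : E, c ≠ 0 → ‖c‖ < ‖c₀‖ → (p, (0 : E)) ∈ evalSubring c →
      ‖PowerSeries.coeff m p‖ ≤ ‖c‖ * (S / ‖c₀‖ ^ (m + 1)) := by
    intro c hc hlt hmem
    have hc0 : 0 < ‖c‖ := norm_pos_iff.2 hc
    have h1 := (mem_evalSubring.1 hmem).2.sub (hasSum_ite_eq m (PowerSeries.coeff m p * c ^ m))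
    have h2 : HasSum (fun n => (‖PowerSeries.coeff n p‖ * ‖c₀‖ ^ n) * (‖c‖ / ‖c₀‖) ^ (m + 1))
      (S * (‖c‖ / ‖c₀‖) ^ (m + 1)) := hs.hasSum.mul_right _
    have h3 := h1.norm_le_of_bounded h2 fun n => by
      rcases lt_trichotomy n m with hn | rfl | hn
      · simp only [hn.ne, if_false, ih n hn]
        simp
      · simp only [if_true, sub_self, norm_zero]
        positivity
      · simp only [hn.ne', if_false, sub_zero, norm_mul, norm_pow, mul_assoc]
        refine mul_le_mul_of_nonneg_left ?_ (norm_nonneg _)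
        calc ‖c‖ ^ n = ‖c₀‖ ^ n * (‖c‖ / ‖c₀‖) ^ n := by
              rw [← mul_pow]; field_simp
          _ ≤ _ := mul_le_mul_of_nonneg_left
            (pow_le_pow_of_le_one (by positivity) ((div_le_one hr).2 hlt.le) hn) (by positivity)
    rw [zero_sub, norm_neg, norm_mul, norm_pow, div_pow, pow_succ ‖c‖] at h3
    have h4 : ‖PowerSeries.coeff m p‖ * ‖c‖ ^ m ≤ (‖c‖ * (S / ‖c₀‖ ^ (m + 1))) * ‖c‖ ^ m := by
      refine h3.trans (le_of_eq ?_)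
      ring
    exact le_of_mul_le_mul_right h4 (by positivity)
  by_contra hne
  have hpos : 0 < ‖PowerSeries.coeff m p‖ := norm_pos_iff.2 hne
  set B := S / ‖c₀‖ ^ (m + 1)
  have hB : 0 ≤ B := by positivity
  obtain ⟨c, hc, hlt, hmem⟩ := h (min ‖c₀‖ (‖PowerSeries.coeff m p‖ / (B + 1)))
    (lt_min hr (by positivity))
  have h1 := hbound c hc (hlt.trans_le (min_le_left _ _)) hmem
  have h2 := hlt.trans_le (min_le_right _ _)
  rw [lt_div_iff₀ (by positivity)] at h2
  nlinarith [norm_nonneg c]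

/-- The formal identity `g(X^d) = ∑ f_i X^(d-i) g^i` is evaluated at `z` inside `evalSubring z`, and
`z^d` is cancelled. -/
lemma aeval_eq_of_defect_eq_zero {K : Type*} [Field K] [Algebra K E] {f : K[X]}
    (hd : f.natDegree ≠ 0) {g : PowerSeries K} (hg : defect f hd g = 0) {z s t : E} (hz : z ≠ 0)
    (hs : (g.map (algebraMap K E), z * s) ∈ evalSubring z)
    (ht : (g.map (algebraMap K E), z ^ f.natDegree * t) ∈ evalSubring (z ^ f.natDegree)) :
    aeval s f = t := by
  have h1 : PowerSeries.expand f.natDegree hd (g.map (algebraMap K E))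
      = ∑ i ∈ Finset.range (f.natDegree + 1), PowerSeries.C (algebraMap K E (f.coeff i))
        * PowerSeries.X ^ (f.natDegree - i) * (g.map (algebraMap K E)) ^ i := by
    have := congrArg (PowerSeries.map (algebraMap K E)) hg
    rw [defect, map_sub, map_sum, map_zero, sub_eq_zero] at this
    rw [← PowerSeries.map_expand, ← this]
    simp [map_mul, map_pow, PowerSeries.map_C]
  have h2 : (∑ i ∈ Finset.range (f.natDegree + 1), PowerSeries.C (algebraMap K E (f.coeff i))
        * PowerSeries.X ^ (f.natDegree - i) * (g.map (algebraMap K E)) ^ i,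
      ∑ i ∈ Finset.range (f.natDegree + 1), algebraMap K E (f.coeff i)
        * z ^ (f.natDegree - i) * (z * s) ^ i) ∈ evalSubring z := by
    have := Subring.sum_mem (evalSubring z) (t := Finset.range (f.natDegree + 1))
      (f := fun i => (PowerSeries.C (algebraMap K E (f.coeff i)), algebraMap K E (f.coeff i))
        * (PowerSeries.X, z) ^ (f.natDegree - i) * (g.map (algebraMap K E), z * s) ^ i)
      fun i _ => mul_mem (mul_mem (C_mem_evalSubring z _) (pow_mem (X_mem_evalSubring z) _))
        (pow_mem hs _)
    convert this using 1
    ext1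
    · rw [Prod.fst_sum]; rfl
    · rw [Prod.snd_sum]; rfl
  have h3 := expand_mem_evalSubring hd ht
  rw [h1] at h3
  have h4 := evalSubring_unique h2 h3
  rw [aeval_eq_sum_range]
  refine mul_left_cancel₀ (pow_ne_zero f.natDegree hz) ?_
  rw [← h4, Finset.mul_sum]
  refine Finset.sum_congr rfl fun i hi => ?_
  have hi' : i ≤ f.natDegree := Nat.lt_succ_iff.1 (Finset.mem_range.1 hi)
  rw [Algebra.smul_def, mul_pow]
  conv_lhs => rw [← Nat.sub_add_cancel hi', pow_add]
  ring

/-- The smallness of the terms of degree at least `2` is what makes `g(z)/z` injective on the circle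
of radius `r`. -/
lemma exists_small_radius {p : PowerSeries E} {z : E} (hz : z ≠ 0)
    (h : Summable fun n => ‖PowerSeries.coeff n p‖ * ‖z‖ ^ n) :
    ∃ ε > 0, ∀ r, 0 ≤ r → r < ε → ∀ n, 2 ≤ n → ‖PowerSeries.coeff n p‖ * r ^ n ≤ 1 / 2 := by
  obtain ⟨C, hC⟩ := h.tendsto_atTop_zero.bddAbove_range
  have hz0 : 0 < ‖z‖ := norm_pos_iff.2 hz
  have hC0 : 0 ≤ C := le_trans (by positivity) (hC ⟨0, rfl⟩)
  refine ⟨min ‖z‖ (‖z‖ / (2 * (C + 1))), lt_min hz0 (by positivity), fun r hr0 hr n hn => ?_⟩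
  have h1 : r / ‖z‖ ≤ 1 := (div_le_one hz0).2 (hr.trans_le (min_le_left _ _)).le
  have h2 : r / ‖z‖ * (2 * (C + 1)) ≤ 1 := by
    have := (hr.trans_le (min_le_right _ _)).le
    rw [le_div_iff₀ (by positivity)] at this
    rw [div_mul_eq_mul_div, div_le_one hz0]
    exact this
  have h3 : 0 ≤ r / ‖z‖ := by positivity
  calc ‖PowerSeries.coeff n p‖ * r ^ n
      = (‖PowerSeries.coeff n p‖ * ‖z‖ ^ n) * (r / ‖z‖) ^ n := by
        rw [div_pow]; field_simp
    _ ≤ C * (r / ‖z‖) ^ 1 := by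
        refine mul_le_mul (hC ⟨n, rfl⟩) (pow_le_pow_of_le_one h3 h1 (by omega))
          (by positivity) hC0
    _ ≤ 1 / 2 := by nlinarith

end Evaluation

/-! ### Injectivity on small circles -/

section Ultrametric

variable {E : Type*} [NormedField E] [IsUltrametricDist E]

lemma norm_hasSum_le {f : ℕ → E} {s : E} {C : ℝ} (hC : 0 ≤ C) (h : HasSum f s)
    (hf : ∀ n, ‖f n‖ ≤ C) : ‖s‖ ≤ C :=
  le_of_tendsto' h.norm fun _ =>
    IsUltrametricDist.norm_sum_le_of_forall_le_of_nonneg hC fun n _ => hf n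

lemma norm_pow_sub_pow_le {u w : E} {r : ℝ} (hu : ‖u‖ ≤ r) (hw : ‖w‖ ≤ r) (n : ℕ) :
    ‖u ^ (n + 1) - w ^ (n + 1)‖ ≤ r ^ n * ‖u - w‖ := by
  have hr : 0 ≤ r := (norm_nonneg u).trans hu
  rw [← Commute.geom_sum₂_mul (Commute.all u w), norm_mul]
  refine mul_le_mul_of_nonneg_right ?_ (norm_nonneg _)
  refine IsUltrametricDist.norm_sum_le_of_forall_le_of_nonneg (by positivity) fun i hi => ?_
  have hin : i ≤ n := Nat.lt_succ_iff.1 (Finset.mem_range.1 hi)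
  rw [norm_mul, norm_pow, norm_pow]
  calc ‖u‖ ^ i * ‖w‖ ^ (n + 1 - 1 - i) ≤ r ^ i * r ^ (n - i) := by
        rw [Nat.add_sub_cancel]
        gcongr
    _ = r ^ n := by rw [← pow_add, Nat.add_sub_cancel' hin]

/-- The function `g(z) / z` is injective on small circles. -/
lemma injOn_small_circle {p : PowerSeries E} (hp : PowerSeries.coeff 0 p = 1) {r : ℝ}
    (hr : ∀ n, 2 ≤ n → ‖PowerSeries.coeff n p‖ * r ^ n ≤ 1 / 2) {u w s : E}
    (hu : ‖u‖ = r) (hw : ‖w‖ = r)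
    (hus : (p, u * s) ∈ evalSubring u) (hws : (p, w * s) ∈ evalSubring w) : u = w := by
  have hr0 : 0 ≤ r := hu ▸ norm_nonneg u
  -- Expand `w g(u) - u g(w) = 0`. The constant term of `g` contributes `w - u`, the linear terms
  -- cancel, and the rest has norm at most `|u - w|/2`; hence `|u - w| ≤ |u - w|/2`.
  have h1 := ((mem_evalSubring.1 hus).2.mul_left w).sub ((mem_evalSubring.1 hws).2.mul_left u)
  have h2 := h1.sub (hasSum_ite_eq 0 (w - u))
  have h3 := norm_hasSum_le (C := 1 / 2 * ‖u - w‖) (by positivity) h2 fun n => by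
    match n with
    | 0 => simp [hp]
    | 1 =>
      have : w * (PowerSeries.coeff 1 p * u ^ 1) - u * (PowerSeries.coeff 1 p * w ^ 1) = 0 := by
        ring
      simp only [this]
      simp
    | n + 2 =>
      have h4 : w * (PowerSeries.coeff (n + 2) p * u ^ (n + 2))
          - u * (PowerSeries.coeff (n + 2) p * w ^ (n + 2))
          = PowerSeries.coeff (n + 2) p * (u * w) * (u ^ (n + 1) - w ^ (n + 1)) := by ring
      simp only [h4, Nat.add_eq_zero_iff, OfNat.ofNat_ne_zero, and_false, if_false, sub_zero]
      rw [norm_mul, norm_mul, norm_mul, hu, hw]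
      calc _ ≤ ‖PowerSeries.coeff (n + 2) p‖ * (r * r) * (r ^ n * ‖u - w‖) :=
            mul_le_mul_of_nonneg_left (norm_pow_sub_pow_le hu.le hw.le n) (by positivity)
        _ = (‖PowerSeries.coeff (n + 2) p‖ * r ^ (n + 2)) * ‖u - w‖ := by ring
        _ ≤ _ := mul_le_mul_of_nonneg_right (hr _ (by omega)) (norm_nonneg _)
  have h5 : w * (u * s) - u * (w * s) - (w - u) = u - w := by ring
  rw [h5] at h3
  have : ‖u - w‖ ≤ 0 := by linarith
  exact sub_eq_zero.1 (norm_le_zero_iff.1 this)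

end Ultrametric

/-! ### Radius of convergence larger than one -/

section LargeRadius

variable {E : Type*} [NormedField E] [IsUltrametricDist E]

/-- Submultiplicativity of the Gauss norm at radius `ρ`. -/
lemma norm_coeff_mul_le {p q : PowerSeries E} {ρ A B : ℝ} (hρ : 0 ≤ ρ) (hA : 0 ≤ A) (hB : 0 ≤ B)
    (hp : ∀ n, ‖PowerSeries.coeff n p‖ * ρ ^ n ≤ A)
    (hq : ∀ n, ‖PowerSeries.coeff n q‖ * ρ ^ n ≤ B) (n : ℕ) :
    ‖PowerSeries.coeff n (p * q)‖ * ρ ^ n ≤ A * B := by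
  rcases hρ.eq_or_lt with rfl | hρ
  · rcases Nat.eq_zero_or_pos n with rfl | hn
    · have h1 := hp 0
      have h2 := hq 0
      simp only [pow_zero, mul_one] at h1 h2 ⊢
      rw [PowerSeries.coeff_mul, Finset.HasAntidiagonal.antidiagonal_zero, Finset.sum_singleton, norm_mul]
      exact mul_le_mul h1 h2 (norm_nonneg _) hA
    · simp only [zero_pow hn.ne', mul_zero]
      positivity
  · rw [PowerSeries.coeff_mul, ← le_div_iff₀ (by positivity)]
    refine IsUltrametricDist.norm_sum_le_of_forall_le_of_nonneg (by positivity) fun kl hkl => ?_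
    rw [le_div_iff₀ (by positivity), ← Finset.HasAntidiagonal.mem_antidiagonal.1 hkl, norm_mul,
      pow_add]
    calc _ = (‖PowerSeries.coeff kl.1 p‖ * ρ ^ kl.1) * (‖PowerSeries.coeff kl.2 q‖ * ρ ^ kl.2) := by
          ring
      _ ≤ _ := mul_le_mul (hp _) (hq _) (by positivity) hA

lemma norm_coeff_pow_le {p : PowerSeries E} {ρ A : ℝ} (hρ : 0 ≤ ρ) (hA : 0 ≤ A)
    (hp : ∀ n, ‖PowerSeries.coeff n p‖ * ρ ^ n ≤ A) (i n : ℕ) :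
    ‖PowerSeries.coeff n (p ^ i)‖ * ρ ^ n ≤ A ^ i := by
  induction i generalizing n with
  | zero =>
    rw [pow_zero, pow_zero, PowerSeries.coeff_one]
    split_ifs with h <;> simp [h]
  | succ i ih =>
    rw [pow_succ, pow_succ]
    exact norm_coeff_mul_le hρ (by positivity) hA ih hp n

variable {K : Type*} [Field K] [Algebra K E]

/-- One iteration step from radius `ρ` to `ρ^d`: the `n`-th coefficient of `g` is the `dn`-th of
`g(X^d)`, and the functional equation bounds the latter by Gauss norms at `ρ`. -/
lemma norm_coeff_le_of_defect_eq_zero {f : K[X]} (hd : f.natDegree ≠ 0) {g : PowerSeries K}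
    (hg : defect f hd g = 0) {F : ℝ} (hF : ∀ i, ‖algebraMap K E (f.coeff i)‖ ≤ F)
    {ρ C : ℝ} (hρ : 0 < ρ) (hC : 1 ≤ C)
    (h : ∀ n, ‖PowerSeries.coeff n (g.map (algebraMap K E))‖ * ρ ^ n ≤ C * ρ) (n : ℕ) :
    ‖PowerSeries.coeff n (g.map (algebraMap K E))‖ * (ρ ^ f.natDegree) ^ n
      ≤ F * C ^ f.natDegree * ρ ^ f.natDegree := by
  have hF0 : 0 ≤ F := (norm_nonneg _).trans (hF 0)
  have h1 : PowerSeries.expand f.natDegree hd (g.map (algebraMap K E))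
      = ∑ i ∈ Finset.range (f.natDegree + 1), PowerSeries.C (algebraMap K E (f.coeff i))
        * (PowerSeries.X ^ (f.natDegree - i) * (g.map (algebraMap K E)) ^ i) := by
    have := congrArg (PowerSeries.map (algebraMap K E)) hg
    rw [defect, map_sub, map_sum, map_zero, sub_eq_zero] at this
    rw [← PowerSeries.map_expand, ← this]
    simp [map_mul, map_pow, PowerSeries.map_C, mul_assoc]
  have hX : ∀ n, ‖PowerSeries.coeff n (PowerSeries.X : PowerSeries E)‖ * ρ ^ n ≤ ρ := by
    intro n
    rw [PowerSeries.coeff_X]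
    split_ifs with h
    · simp [h]
    · simpa using hρ.le
  rw [← PowerSeries.coeff_expand_mul f.natDegree hd, ← pow_mul, h1, map_sum,
    ← le_div_iff₀ (by positivity)]
  refine IsUltrametricDist.norm_sum_le_of_forall_le_of_nonneg (by positivity) fun i hi => ?_
  have hi' : i ≤ f.natDegree := Nat.lt_succ_iff.1 (Finset.mem_range.1 hi)
  rw [PowerSeries.coeff_C_mul, norm_mul, le_div_iff₀ (by positivity), mul_assoc, mul_assoc F]
  refine mul_le_mul (hF i) ?_ (by positivity) hF0
  refine (norm_coeff_mul_le hρ.le (by positivity) (by positivity)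
    (norm_coeff_pow_le hρ.le hρ.le hX (f.natDegree - i))
    (norm_coeff_pow_le hρ.le (by positivity) h i) _).trans ?_
  calc ρ ^ (f.natDegree - i) * (C * ρ) ^ i = C ^ i * (ρ ^ (f.natDegree - i) * ρ ^ i) := by ring
    _ = C ^ i * ρ ^ f.natDegree := by rw [← pow_add, Nat.sub_add_cancel hi']
    _ ≤ _ := mul_le_mul_of_nonneg_right (pow_le_pow_right₀ hC hi') (by positivity)

/-- If `X * Ψ` has radius of convergence larger than `1`, then it is a polynomial. -/
lemma exists_eq_polynomial_of_one_lt {f : K[X]} (hd : 2 ≤ f.natDegree) {g : PowerSeries K}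
    (hg : defect f (by omega) g = 0) {ρ C : ℝ} (hρ : 1 < ρ)
    (h : ∀ n, ‖PowerSeries.coeff n (g.map (algebraMap K E))‖ * ρ ^ n ≤ C) :
    ∃ p : K[X], g = p := by
  obtain ⟨F, hF1, hF⟩ : ∃ F : ℝ, 1 ≤ F ∧ ∀ i, ‖algebraMap K E (f.coeff i)‖ ≤ F := by
    refine ⟨1 + ∑ i ∈ f.support, ‖algebraMap K E (f.coeff i)‖, ?_, fun i => ?_⟩
    · have : 0 ≤ ∑ i ∈ f.support, ‖algebraMap K E (f.coeff i)‖ :=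
        Finset.sum_nonneg fun i _ => norm_nonneg _
      linarith
    · by_cases hi : i ∈ f.support
      · have := Finset.single_le_sum (f := fun i => ‖algebraMap K E (f.coeff i)‖)
          (fun i _ => norm_nonneg _) hi
        linarith
      · rw [Polynomial.notMem_support_iff.1 hi, map_zero, norm_zero]
        have : 0 ≤ ∑ i ∈ f.support, ‖algebraMap K E (f.coeff i)‖ :=
          Finset.sum_nonneg fun i _ => norm_nonneg _
        linarith
  set D := max C 1
  have hD1 : 1 ≤ D := le_max_right _ _
  -- The bound `B` becomes `F * B^d`. Controlling `F * B` instead of `B` closes the induction, since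
  -- `F^2 ≤ F^d`.
  have hiter : ∀ k : ℕ, ∃ B : ℝ, 1 ≤ B ∧ F * B ≤ (F * D) ^ (f.natDegree ^ k) ∧
      ∀ n, ‖PowerSeries.coeff n (g.map (algebraMap K E))‖ * (ρ ^ (f.natDegree ^ k)) ^ n
        ≤ B * ρ ^ (f.natDegree ^ k) := by
    intro k
    induction k with
    | zero =>
      refine ⟨D, hD1, by simp, fun n => ?_⟩
      rw [pow_zero, pow_one]
      calc _ ≤ C := h n
        _ ≤ D * 1 := by rw [mul_one]; exact le_max_left _ _
        _ ≤ _ := mul_le_mul_of_nonneg_left hρ.le (by positivity)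
    | succ k ih =>
      obtain ⟨B, hB1, hB2, hB3⟩ := ih
      refine ⟨F * B ^ f.natDegree, ?_, ?_, fun n => ?_⟩
      · exact one_le_mul_of_one_le_of_one_le hF1 (one_le_pow₀ hB1)
      · calc F * (F * B ^ f.natDegree) = F ^ 2 * B ^ f.natDegree := by ring
          _ ≤ F ^ f.natDegree * B ^ f.natDegree :=
            mul_le_mul_of_nonneg_right (pow_le_pow_right₀ hF1 hd) (by positivity)
          _ = (F * B) ^ f.natDegree := by rw [mul_pow]
          _ ≤ ((F * D) ^ (f.natDegree ^ k)) ^ f.natDegree :=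
            pow_le_pow_left₀ (by positivity) hB2 _
          _ = _ := by rw [← pow_mul, pow_succ]
      · have := norm_coeff_le_of_defect_eq_zero (E := E) (by omega) hg hF
          (show 0 < ρ ^ (f.natDegree ^ k) by positivity) hB1 hB3 n
        rwa [← pow_mul ρ, ← pow_succ] at this
  -- For `n ≥ N` the iterated bound gives `|g_n| ≤ (F D ρ / ρ^n)^(d^k)` with base less than `1`; let
  -- `k` tend to infinity.
  obtain ⟨N, hN⟩ := pow_unbounded_of_one_lt (F * D * ρ) hρ
  have hvan : ∀ n, N ≤ n → PowerSeries.coeff n g = 0 := by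
    intro n hn
    have hlt : F * D * ρ < ρ ^ n := hN.trans_le (pow_le_pow_right₀ hρ.le hn)
    have hq1 : F * D * ρ / ρ ^ n < 1 := (div_lt_one (by positivity)).2 hlt
    have hq0 : 0 ≤ F * D * ρ / ρ ^ n := by positivity
    have hb : ∀ k : ℕ, ‖PowerSeries.coeff n (g.map (algebraMap K E))‖
        ≤ (F * D * ρ / ρ ^ n) ^ k := by
      intro k
      obtain ⟨B, hB1, hB2, hB3⟩ := hiter k
      have hB4 : B ≤ (F * D) ^ (f.natDegree ^ k) := by nlinarith
      have h1 : ‖PowerSeries.coeff n (g.map (algebraMap K E))‖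
          ≤ (F * D * ρ / ρ ^ n) ^ (f.natDegree ^ k) := by
        rw [div_pow, le_div_iff₀ (by positivity), mul_pow, ← pow_mul, mul_comm n, pow_mul]
        exact (hB3 n).trans (mul_le_mul_of_nonneg_right hB4 (by positivity))
      exact h1.trans (pow_le_pow_of_le_one hq0 hq1.le (Nat.lt_pow_self (by omega)).le)
    have h0 : ‖PowerSeries.coeff n (g.map (algebraMap K E))‖ ≤ 0 :=
      ge_of_tendsto' (tendsto_pow_atTop_nhds_zero_of_lt_one hq0 hq1) hb
    rw [norm_le_zero_iff, PowerSeries.coeff_map] at h0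
    exact (map_eq_zero _).1 h0
  refine ⟨PowerSeries.trunc N g, ?_⟩
  ext n
  rw [Polynomial.coeff_coe, PowerSeries.coeff_trunc]
  split_ifs with hn
  · rfl
  · exact hvan n (not_lt.1 hn)

end LargeRadius

/-! ### The dimension count -/

section Counting

variable {K : Type*} [Field K]

lemma mem_restrictDegree_iff_degreeOf {p : MvPolynomial (Fin 2) K} {m : ℕ} :
    p ∈ MvPolynomial.restrictDegree (Fin 2) K m ↔ ∀ i, p.degreeOf i ≤ m := by
  simp only [MvPolynomial.mem_restrictDegree, MvPolynomial.degreeOf_le_iff]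
  exact ⟨fun h i s hs => h s hs i, fun h s hs i => h i s hs⟩

lemma finrank_restrictDegree (m : ℕ) :
    Module.finrank K (MvPolynomial.restrictDegree (Fin 2) K m) = (m + 1) ^ 2 := by
  have hb := Module.finrank_eq_nat_card_basis
    (MvPolynomial.basisRestrictSupport K {n : Fin 2 →₀ ℕ | ∀ i, n i ≤ m})
  refine hb.trans ?_
  let e : {n : Fin 2 →₀ ℕ | ∀ i, n i ≤ m} ≃ (Fin 2 → Fin (m + 1)) :=
    { toFun := fun n i => ⟨n.1 i, Nat.lt_succ_of_le (n.2 i)⟩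
      invFun := fun n => ⟨Finsupp.equivFunOnFinite.symm fun i => (n i : ℕ),
        fun i => Nat.lt_succ_iff.1 (n i).2⟩
      left_inv := fun n => by ext i; simp
      right_inv := fun n => by ext i; simp }
  rw [Nat.card_congr e]
  simp

/-- `w(F(X), F(Y))`. -/
def diagComp (F : K[X]) : MvPolynomial (Fin 2) K →ₐ[K] MvPolynomial (Fin 2) K :=
  MvPolynomial.aeval fun i => Polynomial.aeval (MvPolynomial.X i : MvPolynomial (Fin 2) K) F

lemma aeval_diagComp {E : Type*} [Field E] [Algebra K E] (F : K[X]) (w : MvPolynomial (Fin 2) K)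
    (a b : E) : MvPolynomial.aeval ![a, b] (diagComp F w)
      = MvPolynomial.aeval ![aeval a F, aeval b F] w := by
  rw [← AlgHom.comp_apply]
  refine congrFun (congrArg DFunLike.coe (MvPolynomial.algHom_ext fun i => ?_)) w
  rw [AlgHom.comp_apply, diagComp, MvPolynomial.aeval_X, MvPolynomial.aeval_X,
    ← Polynomial.aeval_algHom_apply, MvPolynomial.aeval_X]
  fin_cases i <;> simp

lemma degreeOf_aeval_X_le (F : K[X]) (i j : Fin 2) :
    (Polynomial.aeval (MvPolynomial.X i : MvPolynomial (Fin 2) K) F).degreeOf j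
      ≤ if i = j then F.natDegree else 0 := by
  rw [Polynomial.aeval_eq_sum_range]
  refine (MvPolynomial.degreeOf_sum_le _ _ _).trans (Finset.sup_le fun n hn => ?_)
  rw [MvPolynomial.smul_eq_C_mul]
  refine (MvPolynomial.degreeOf_C_mul_le _ _ _).trans ((MvPolynomial.degreeOf_pow_le _ _ _).trans ?_)
  have hn' := Nat.lt_succ_iff.1 (Finset.mem_range.1 hn)
  rw [MvPolynomial.degreeOf_X]
  split_ifs with h1 h2 h2
  · simpa using hn'
  · exact absurd h1.symm h2
  · simp
  · simp

lemma degreeOf_diagComp_le {F : K[X]} {N D : ℕ} (hF : F.natDegree ≤ N)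
    {w : MvPolynomial (Fin 2) K} (hw : w ∈ MvPolynomial.restrictDegree (Fin 2) K D) (j : Fin 2) :
    (diagComp F w).degreeOf j ≤ N * D := by
  rw [diagComp, MvPolynomial.aeval_eq_eval₂Hom, MvPolynomial.coe_eval₂Hom,
    MvPolynomial.eval₂_eq]
  refine (MvPolynomial.degreeOf_sum_le _ _ _).trans (Finset.sup_le fun s hs => ?_)
  rw [MvPolynomial.algebraMap_eq]
  refine (MvPolynomial.degreeOf_C_mul_le _ _ _).trans ?_
  refine (MvPolynomial.degreeOf_prod_le _ _ _).trans ?_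
  have hsD := (MvPolynomial.mem_restrictDegree _ _ _).1 hw s hs
  calc ∑ i ∈ s.support, MvPolynomial.degreeOf j
        (Polynomial.aeval (MvPolynomial.X i : MvPolynomial (Fin 2) K) F ^ s i)
      ≤ ∑ i ∈ s.support, if i = j then N * D else 0 := by
        refine Finset.sum_le_sum fun i _ => ?_
        refine (MvPolynomial.degreeOf_pow_le _ _ _).trans ?_
        have := degreeOf_aeval_X_le F i j
        split_ifs at this ⊢ with h
        · rw [mul_comm N]
          exact Nat.mul_le_mul (hsD i) (this.trans hF)
        · simp [Nat.le_zero.1 this]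
    _ ≤ N * D := by
        rw [Finset.sum_ite_eq']
        split_ifs <;> simp

/-- If `h₁, h₂` satisfied no relation of degree at most `D`, the polynomials `∑ w_s(F(X), F(Y)) X^s`
would be independent of each other and of the multiples of `Q`, because a fibre of `π` carries `n`
distinct values of `A`. There is no room for them: modulo multiples of `Q`, bidegree at most `M`
leaves only about `2 D₀ M` dimensions. -/
theorem exists_relation_of_fibres {E T : Type*} [Field E] [Algebra K E] {A B h₁ h₂ : T → E} {π : T → T}
    (hπ : Function.Surjective π) {F : K[X]} {N D D₀ n : ℕ} (hF : F.natDegree ≤ N)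
    (hh₁ : ∀ x, h₁ (π x) = aeval (A x) F) (hh₂ : ∀ x, h₂ (π x) = aeval (B x) F)
    {Q : MvPolynomial (Fin 2) K} (hQ0 : Q ≠ 0)
    (hQ : Q ∈ MvPolynomial.restrictDegree (Fin 2) K D₀)
    (hvan : ∀ x, MvPolynomial.aeval ![A x, B x] Q = 0)
    (hfib : ∀ x, ∃ ξ : Fin n → T, (∀ j, π (ξ j) = π x) ∧ Function.Injective (A ∘ ξ))
    (hnN : n ≤ N) (hcount : 2 * D₀ * (N * (D + 1) + 1) < (D + 1) ^ 2 * n) :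
    ∃ Q' : MvPolynomial (Fin 2) K, Q' ≠ 0 ∧ Q' ∈ MvPolynomial.restrictDegree (Fin 2) K D ∧
      ∀ y, MvPolynomial.aeval ![h₁ y, h₂ y] Q' = 0 := by
  by_contra hcon
  push Not at hcon
  set M := N * (D + 1) with hM
  -- Needed so that `M - D₀` is not truncated. If `D₀ > M`, then `(D+1)^2 n ≤ (M+1)^2 ≤ 2 D₀ (M+1)`,
  -- against `hcount`.
  have hDM : D₀ ≤ M := by
    by_contra h
    have h1 : (D + 1) ^ 2 * n ≤ (M + 1) * (M + 1) := by
      have h2 : (D + 1) * n ≤ M := by rw [hM, mul_comm]; exact Nat.mul_le_mul_right _ hnN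
      rcases Nat.eq_zero_or_pos n with rfl | hn
      · simp
      · have h3 : D + 1 ≤ M := le_trans (Nat.le_mul_of_pos_right _ hn) h2
        calc (D + 1) ^ 2 * n = (D + 1) * ((D + 1) * n) := by ring
          _ ≤ _ := Nat.mul_le_mul (by omega) (by omega)
    have : (M + 1) * (M + 1) ≤ 2 * D₀ * (M + 1) := Nat.mul_le_mul_right _ (by omega)
    omega
  let V := MvPolynomial.restrictDegree (Fin 2) K M
  let W := MvPolynomial.restrictDegree (Fin 2) K D
  let V' := MvPolynomial.restrictDegree (Fin 2) K (M - D₀)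
  let Φ : ((Fin n → W) × V') →ₗ[K] MvPolynomial (Fin 2) K :=
    LinearMap.coprod
      (∑ s : Fin n, (LinearMap.mulRight K (MvPolynomial.X 0 ^ (s : ℕ))).comp
        ((diagComp F).toLinearMap.comp (W.subtype.comp (LinearMap.proj s))))
      ((LinearMap.mulLeft K Q).comp V'.subtype)
  have hL : ∀ w v, Φ (w, v) = ∑ s : Fin n, diagComp F (w s).1 * MvPolynomial.X 0 ^ (s : ℕ)
      + Q * v.1 := by
    intro w v
    simp [Φ, LinearMap.sum_apply]
  have hLV : ∀ x, Φ x ∈ V := by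
    rintro ⟨w, v⟩
    rw [hL]
    refine add_mem (sum_mem fun s _ => ?_) ?_
    · refine mem_restrictDegree_iff_degreeOf.2 fun i => ?_
      refine (MvPolynomial.degreeOf_mul_le _ _ _).trans ?_
      have h1 := degreeOf_diagComp_le hF (w s).2 i
      have h2 : MvPolynomial.degreeOf i ((MvPolynomial.X 0 : MvPolynomial (Fin 2) K) ^ (s : ℕ))
          ≤ N := by
        refine (MvPolynomial.degreeOf_pow_le _ _ _).trans ?_
        have := s.2
        rw [MvPolynomial.degreeOf_X]
        split_ifs <;> omega
      calc _ ≤ N * D + N := add_le_add h1 h2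
        _ = M := by rw [hM]; ring
    · refine mem_restrictDegree_iff_degreeOf.2 fun i => ?_
      refine (MvPolynomial.degreeOf_mul_le _ _ _).trans ?_
      have h1 := mem_restrictDegree_iff_degreeOf.1 hQ i
      have h2 := mem_restrictDegree_iff_degreeOf.1 v.2 i
      omega
  -- On a fibre of `π` the term with `Q` vanishes and the values of the `w_s(F, F)` are constant, so
  -- a Vandermonde argument in the `n` values of `A` kills each of them. Then `w = 0` by the assumed
  -- absence of relations, and `Q v = 0` gives `v = 0`.
  have hinj : Function.Injective (Φ.codRestrict V hLV) := by
    rw [← LinearMap.ker_eq_bot, LinearMap.ker_codRestrict, LinearMap.ker_eq_bot']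
    rintro ⟨w, v⟩ h0
    rw [hL] at h0
    have hw : ∀ s, w s = 0 := by
      have hzero : ∀ x s, MvPolynomial.aeval ![h₁ (π x), h₂ (π x)] (w s).1 = 0 := by
        intro x
        obtain ⟨ξ, hξ, hξi⟩ := hfib x
        have h1 : ∀ j, ∑ s : Fin n, MvPolynomial.aeval ![h₁ (π x), h₂ (π x)] (w s).1
            * (A ∘ ξ) j ^ (s : ℕ) = 0 := by
          intro j
          have := congrArg (MvPolynomial.aeval ![A (ξ j), B (ξ j)]) h0
          rw [map_add, map_mul, hvan, zero_mul, add_zero, map_zero, map_sum] at this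
          rw [← this]
          refine Finset.sum_congr rfl fun s _ => ?_
          rw [map_mul, map_pow, aeval_diagComp, MvPolynomial.aeval_X, ← hh₁, ← hh₂, hξ]
          simp
        have := Matrix.eq_zero_of_forall_index_sum_mul_pow_eq_zero hξi h1
        exact fun s => congrFun this s
      intro s
      by_contra hne
      obtain ⟨y, hy⟩ := hcon (w s).1 (fun h => hne (Subtype.ext h)) (w s).2
      obtain ⟨x, rfl⟩ := hπ y
      exact hy (hzero x s)
    have hw' : w = 0 := funext hw
    subst hw'
    simp only [Pi.zero_apply, ZeroMemClass.coe_zero, map_zero, zero_mul, Finset.sum_const_zero,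
      zero_add, mul_eq_zero, hQ0, false_or] at h0
    rw [Prod.mk_eq_zero]
    exact ⟨rfl, Subtype.ext h0⟩
  have hrank := LinearMap.finrank_le_finrank_of_injective hinj
  rw [Module.finrank_prod, Module.finrank_pi_fintype] at hrank
  simp only [V, W, V', finrank_restrictDegree, Finset.sum_const, Finset.card_univ, Fintype.card_fin,
    smul_eq_mul] at hrank
  -- The ranks give `(D+1)^2 n ≤ (M+1)^2 - (M-D₀+1)^2 ≤ 2 D₀ (M+1)`.
  obtain ⟨k, hk⟩ := Nat.exists_eq_add_of_le hDM
  rw [hk] at hrank hcount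
  rw [Nat.add_sub_cancel_left] at hrank
  nlinarith

end Counting

/-! ### Formal relations between rescaled power series -/

section Formal

/-- If all minors of maximal size of a family of functions vanish, then the functions are linearly
dependent. -/
lemma exists_relation_of_det_eq_zero {R T : Type*} [CommRing R] [IsDomain R] {n : ℕ}
    (v : Fin n → T → R)
    (h : ∀ y : Fin n → T, (Matrix.of fun i j => v i (y j)).det = 0) :
    ∃ φ : Fin n → R, φ ≠ 0 ∧ ∀ t, ∑ i, φ i * v i t = 0 := by
  induction n with
  | zero => exact absurd (h Fin.elim0) (by simp)
  | succ n ih =>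
    by_cases h' : ∀ y : Fin n → T, (Matrix.of fun i j => v (Fin.succ i) (y j)).det = 0
    · obtain ⟨φ, hφ, hrel⟩ := ih (fun i => v i.succ) h'
      refine ⟨Fin.cons 0 φ, fun h0 => hφ (funext fun i => ?_), fun t => ?_⟩
      · simpa using congrFun h0 i.succ
      · simpa [Fin.sum_univ_succ] using hrel t
    · push Not at h'
      obtain ⟨y, hy⟩ := h'
      -- The coefficients are cofactors along the first column: with `t` prepended to `y`, the
      -- relation is the Laplace expansion of a vanishing determinant. The coefficient at `0` is the
      -- minor assumed non-zero.
      refine ⟨fun i => (-1) ^ (i : ℕ) * (Matrix.of fun a b => v (i.succAbove a) (y b)).det,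
        fun h0 => hy ?_, fun t => ?_⟩
      · simpa using congrFun h0 0
      · have := h (Fin.cons t y)
        rw [Matrix.det_succ_column_zero] at this
        rw [← this]
        refine Finset.sum_congr rfl fun i _ => ?_
        simp only [Matrix.of_apply, Fin.cons_zero]
        have hsub : (Matrix.of fun i j => v i ((Fin.cons t y : Fin (n + 1) → T) j)).submatrix
            i.succAbove Fin.succ = Matrix.of fun a b => v (i.succAbove a) (y b) := by
          ext a b
          simp
        rw [hsub]
        ring

variable {E : Type*} [Field E]

/-- The coefficients of a Laurent polynomial with infinitely many zeros vanish. -/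
lemma sum_filter_eq_zero_of_infinite {α : Type*} (A : Finset α) (c : α → E) (w : α → ℤ) {S : Set E}
    (hS : S.Infinite) (hS0 : ∀ y ∈ S, y ≠ 0) (h : ∀ y ∈ S, ∑ a ∈ A, c a * y ^ w a = 0) (m : ℤ) :
    ∑ a ∈ A with w a = m, c a = 0 := by
  obtain ⟨W, hW⟩ : ∃ W : ℕ, ∀ a ∈ A, 0 ≤ w a + W := by
    refine ⟨∑ a ∈ A, (w a).natAbs, fun a ha => ?_⟩
    have := Finset.single_le_sum (f := fun a => (w a).natAbs) (fun _ _ => Nat.zero_le _) ha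
    omega
  set P : E[X] := ∑ a ∈ A, monomial (w a + W).toNat (c a) with hP
  have hP0 : P = 0 := by
    refine Polynomial.eq_zero_of_infinite_isRoot P (hS.mono fun y hy => ?_)
    have hy0 := hS0 y hy
    show P.eval y = 0
    have h1 : P.eval y = y ^ (W : ℤ) * ∑ a ∈ A, c a * y ^ w a := by
      rw [hP, Polynomial.eval_finsetSum, Finset.mul_sum]
      refine Finset.sum_congr rfl fun a ha => ?_
      rw [Polynomial.eval_monomial, ← zpow_natCast, Int.toNat_of_nonneg (hW a ha), zpow_add₀ hy0]
      ring
    rw [h1, h y hy, mul_zero]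
  by_cases hm : ∃ a ∈ A, w a = m
  · obtain ⟨a₀, ha₀, rfl⟩ := hm
    have h2 := congrArg (fun p => Polynomial.coeff p (w a₀ + W).toNat) hP0
    simp only [hP, Polynomial.finsetSum_coeff, Polynomial.coeff_monomial,
      Polynomial.coeff_zero] at h2
    rw [Finset.sum_filter]
    refine Eq.trans ?_ h2
    refine Finset.sum_congr rfl fun a ha => ?_
    have h3 := hW a ha
    have h4 := hW a₀ ha₀
    by_cases h5 : w a = w a₀
    · simp [h5]
    · rw [if_neg h5, if_neg (by omega)]
  · push Not at hm
    rw [Finset.filter_eq_empty_iff.2 fun a ha => hm a ha, Finset.sum_empty]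

lemma coeff_mul_mul_eq_sum_box (a b c : PowerSeries E) {n M : ℕ} (hM : n < M) :
    PowerSeries.coeff n (a * b * c) = ∑ x ∈ Finset.range M ×ˢ Finset.range M with x.1 + x.2 ≤ n,
      PowerSeries.coeff x.1 a * PowerSeries.coeff x.2 b * PowerSeries.coeff (n - x.1 - x.2) c := by
  rw [PowerSeries.coeff_mul]
  simp only [PowerSeries.coeff_mul, Finset.sum_mul]
  rw [Finset.sum_sigma']
  refine Finset.sum_nbij' (fun x => x.2) (fun x => ⟨(x.1 + x.2, n - x.1 - x.2), x⟩) ?_ ?_ ?_ ?_ ?_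
  · rintro ⟨⟨u, w⟩, ⟨e, s⟩⟩ h
    simp at h ⊢
    omega
  · rintro ⟨e, s⟩ h
    simp at h ⊢
    omega
  · rintro ⟨⟨u, w⟩, ⟨e, s⟩⟩ h
    simp at h ⊢
    omega
  · rintro ⟨e, s⟩ h
    rfl
  · rintro ⟨⟨u, w⟩, ⟨e, s⟩⟩ h
    simp only [Finset.mem_sigma, Finset.HasAntidiagonal.mem_antidiagonal] at h ⊢
    obtain ⟨h1, rfl⟩ := h
    rw [show n - e - s = w by omega]

variable {ι κ : Type*} [Fintype ι] [Fintype κ]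

/-- The left side is the coefficient of `X^n y^(k₁ n - N)`: degrees `e` from `φ`, `s` from `q` and
`n - e - s` from `p` give the `y`-exponent `k₁ n - (k₁ e + (k₁ - k₂) s)`. Only finitely many terms
have degree `n` in `X`, so infinitely many `y` separate the exponents. -/
lemma sum_line_eq_zero {p : ι → PowerSeries E} {q : κ → PowerSeries E} {φ : ι → κ → PowerSeries E}
    {k₁ k₂ : ℤ} {S : Set E} (hS : S.Infinite) (hS0 : ∀ y ∈ S, y ≠ 0)
    (h : ∀ y ∈ S, ∑ i, ∑ j, φ i j * (PowerSeries.rescale (y ^ k₁) (p i)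
      * PowerSeries.rescale (y ^ k₂) (q j)) = 0) {n M : ℕ} (hM : n < M) (N : ℤ) :
    ∑ x ∈ Finset.range M ×ˢ Finset.range M with x.1 + x.2 ≤ n ∧ k₁ * x.1 + (k₁ - k₂) * x.2 = N,
      ∑ i, (∑ j, PowerSeries.coeff x.1 (φ i j) * PowerSeries.coeff x.2 (q j))
        * PowerSeries.coeff (n - x.1 - x.2) (p i) = 0 := by
  have h1 := sum_filter_eq_zero_of_infinite
    ((Finset.range M ×ˢ Finset.range M).filter fun x => x.1 + x.2 ≤ n)
    (fun x => ∑ i, (∑ j, PowerSeries.coeff x.1 (φ i j) * PowerSeries.coeff x.2 (q j))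
        * PowerSeries.coeff (n - x.1 - x.2) (p i))
    (fun x => k₁ * n - (k₁ * x.1 + (k₁ - k₂) * x.2)) hS hS0 ?_ (k₁ * n - N)
  · rw [Finset.filter_filter] at h1
    rw [← h1]
    refine Finset.sum_congr (Finset.filter_congr fun x _ => ?_) fun _ _ => rfl
    constructor
    · rintro ⟨h2, h3⟩
      exact ⟨h2, by omega⟩
    · rintro ⟨h2, h3⟩
      exact ⟨h2, by omega⟩
  · intro y hy
    have hy0 := hS0 y hy
    have h2 := congrArg (PowerSeries.coeff n) (h y hy)
    rw [map_zero, map_sum] at h2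
    rw [← h2]
    simp only [Finset.sum_mul]
    rw [Finset.sum_comm]
    refine Finset.sum_congr rfl fun i _ => ?_
    rw [map_sum, Finset.sum_comm]
    refine Finset.sum_congr rfl fun j _ => ?_
    rw [mul_comm (PowerSeries.rescale _ (p i)), ← mul_assoc, coeff_mul_mul_eq_sum_box _ _ _ hM]
    refine Finset.sum_congr rfl fun x hx => ?_
    have hx' : x.1 + x.2 ≤ n := (Finset.mem_filter.1 hx).2
    rw [PowerSeries.coeff_rescale, PowerSeries.coeff_rescale, ← zpow_natCast, ← zpow_natCast,
      ← zpow_mul, ← zpow_mul]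
    have h3 : y ^ (k₁ * n - (k₁ * x.1 + (k₁ - k₂) * x.2))
        = y ^ (k₂ * (x.2 : ℕ)) * y ^ (k₁ * ((n - x.1 - x.2 : ℕ) : ℤ)) := by
      rw [← zpow_add₀ hy0]
      congr 1
      have : ((n - x.1 - x.2 : ℕ) : ℤ) = n - x.1 - x.2 := by omega
      rw [this]
      ring
    rw [h3]
    ring

/-- Linear independence over the polynomial ring. -/
def PolyIndep (p : ι → PowerSeries E) : Prop :=
  ∀ c : ι → E[X], ∑ i, (c i : PowerSeries E) * p i = 0 → c = 0

/-- For `k₁ > 0` and `k₁ > k₂` each line `k₁ e + (k₁ - k₂) s = N` meets the quadrant in a finite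
set. Fixing `N` and letting `n` vary therefore gives a relation between the `p_i` with polynomial
coefficients. Independence of `p`, then of `q`, finishes. -/
lemma eq_zero_of_forall_rescale_of_pos {p : ι → PowerSeries E} {q : κ → PowerSeries E}
    {φ : ι → κ → PowerSeries E} (hp : PolyIndep p) (hq : PolyIndep q)
    {k₁ k₂ : ℤ} (hk₁ : 0 < k₁) (hk₂ : k₂ ≠ 0) (hk : k₂ < k₁) {S : Set E} (hS : S.Infinite)
    (hS0 : ∀ y ∈ S, y ≠ 0)
    (h : ∀ y ∈ S, ∑ i, ∑ j, φ i j * (PowerSeries.rescale (y ^ k₁) (p i)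
      * PowerSeries.rescale (y ^ k₂) (q j)) = 0) : φ = 0 := by
  have hχ : ∀ i e s, ∑ j, PowerSeries.coeff e (φ i j) * PowerSeries.coeff s (q j) = 0 := by
    intro i₀ e₀ s₀
    obtain ⟨N, hN⟩ : ∃ N : ℕ, k₁ * e₀ + (k₁ - k₂) * s₀ = N :=
      Int.eq_ofNat_of_zero_le (by
        have : 0 ≤ k₁ - k₂ := by omega
        positivity)
    have hbox : ∀ e s : ℕ, k₁ * e + (k₁ - k₂) * s = N → e < N + 1 ∧ s < N + 1 := by
      intro e s hes
      constructor <;> zify <;> nlinarith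
    set L := (Finset.range (N + 1) ×ˢ Finset.range (N + 1)).filter
      fun x => k₁ * x.1 + (k₁ - k₂) * x.2 = (N : ℤ) with hL
    set χ : ι → ℕ × ℕ → E := fun i x =>
      ∑ j, PowerSeries.coeff x.1 (φ i j) * PowerSeries.coeff x.2 (q j) with hχdef
    -- The polynomial coefficient of `p_i` is `∑ χ_i(e,s) X^(e+s)` over the line; coefficient by
    -- coefficient the relation is `sum_line_eq_zero`.
    have hc := hp (fun i => ∑ x ∈ L, monomial (x.1 + x.2) (χ i x)) (by
      ext n
      rw [map_sum, map_zero, ← sum_line_eq_zero hS hS0 h (n := n) (M := max n N + 1)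
        (by omega) N, Finset.sum_comm]
      refine Finset.sum_congr rfl fun i _ => ?_
      have hcast : ((∑ x ∈ L, monomial (x.1 + x.2) (χ i x) : E[X]) : PowerSeries E)
          = ∑ x ∈ L, PowerSeries.C (χ i x) * PowerSeries.X ^ (x.1 + x.2) := by
        have := map_sum (Polynomial.coeToPowerSeries.ringHom (R := E))
          (fun x : ℕ × ℕ => monomial (x.1 + x.2) (χ i x)) L
        simp only [Polynomial.coeToPowerSeries.ringHom_apply] at this
        rw [this]
        refine Finset.sum_congr rfl fun x _ => ?_
        rw [← Polynomial.C_mul_X_pow_eq_monomial]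
        simp
      rw [hcast, Finset.sum_mul, map_sum]
      have hfil : (Finset.range (max n N + 1) ×ˢ Finset.range (max n N + 1)).filter
          (fun x => x.1 + x.2 ≤ n ∧ k₁ * x.1 + (k₁ - k₂) * x.2 = (N : ℤ))
          = L.filter fun x => x.1 + x.2 ≤ n := by
        ext x
        simp only [hL, Finset.mem_filter, Finset.mem_product, Finset.mem_range]
        constructor
        · rintro ⟨h1, h2, h3⟩
          exact ⟨⟨hbox _ _ h3, h3⟩, h2⟩
        · rintro ⟨⟨h1, h2⟩, h3⟩
          exact ⟨by omega, h3, h2⟩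
      rw [hfil]
      refine Eq.trans ?_ (Finset.sum_filter _ _).symm
      refine Finset.sum_congr rfl fun x _ => ?_
      rw [mul_assoc, PowerSeries.coeff_C_mul, PowerSeries.coeff_X_pow_mul', mul_ite, mul_zero,
        Nat.sub_sub])
    have hc' := congrArg (fun r : E[X] => r.coeff (e₀ + s₀)) (congrFun hc i₀)
    simp only [Polynomial.finsetSum_coeff, Polynomial.coeff_monomial, Pi.zero_apply,
      Polynomial.coeff_zero] at hc'
    rw [Finset.sum_eq_single (e₀, s₀)] at hc'
    · simpa using hc'
    · rintro ⟨e, s⟩ hx hne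
      rw [if_neg]
      intro hes
      have h1 := (Finset.mem_filter.1 hx).2
      simp only at hes h1
      -- On the line `k₁ (e + s) - k₂ s = N`, so the exponent `e + s` determines the point because
      -- `k₂ ≠ 0`. No two `χ` merge into one coefficient.
      have h2 : (k₂ : ℤ) * ((s : ℤ) - s₀) = 0 := by
        have h3 : (e : ℤ) + s = e₀ + s₀ := by exact_mod_cast hes
        linear_combination k₁ * h3 - h1 + hN
      have h3 : s = s₀ := by
        have := (mul_eq_zero.1 h2).resolve_left hk₂
        omega
      exact hne (by rw [Prod.mk.injEq]; omega)
    · intro hx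
      refine absurd ?_ hx
      rw [hL, Finset.mem_filter, Finset.mem_product, Finset.mem_range, Finset.mem_range]
      exact ⟨hbox _ _ hN, hN⟩
  funext i j
  ext e
  have := hq (fun j => C (PowerSeries.coeff e (φ i j))) (by
    ext s
    rw [map_sum, map_zero, ← hχ i e s]
    simp [PowerSeries.coeff_C_mul])
  simpa using congrFun this j

/-- Replacing `y` by `y⁻¹` changes both signs and exchanging `p` with `q` swaps the exponents, which
reduces to `0 < k₁` and `k₂ < k₁`. -/
lemma eq_zero_of_forall_rescale {p : ι → PowerSeries E} {q : κ → PowerSeries E}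
    {φ : ι → κ → PowerSeries E} (hp : PolyIndep p) (hq : PolyIndep q)
    {k₁ k₂ : ℤ} (hk₁ : k₁ ≠ 0) (hk₂ : k₂ ≠ 0) (hk : k₁ ≠ k₂) {S : Set E} (hS : S.Infinite)
    (hS0 : ∀ y ∈ S, y ≠ 0) (hSinv : ∀ y ∈ S, y⁻¹ ∈ S)
    (h : ∀ y ∈ S, ∑ i, ∑ j, φ i j * (PowerSeries.rescale (y ^ k₁) (p i)
      * PowerSeries.rescale (y ^ k₂) (q j)) = 0) : φ = 0 := by
  wlog hpos : 0 < k₁ generalizing k₁ k₂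
  · refine this (k₁ := -k₁) (k₂ := -k₂) (by omega) (by omega) (by omega) (fun y hy => ?_) (by omega)
    have := h _ (hSinv y hy)
    simpa only [inv_zpow'] using this
  rcases lt_or_gt_of_ne hk with hlt | hgt
  · have h1 := eq_zero_of_forall_rescale_of_pos (φ := fun j i => φ i j) hq hp (hpos.trans hlt) hk₁
      hlt hS hS0 (fun y hy => by
        rw [← h y hy, Finset.sum_comm]
        refine Finset.sum_congr rfl fun i _ => Finset.sum_congr rfl fun j _ => ?_
        ring)
    funext i j
    exact congrFun (congrFun h1 j) i
  · exact eq_zero_of_forall_rescale_of_pos hp hq hpos hk₂ hgt hS hS0 h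

end Formal

/-! ### Transcendence degree -/

section Algebraic

variable {K E : Type*} [Field K] [Field E] [Algebra K E]

/-- Any `K`-linear functional `E → K`, applied coefficientwise, turns a relation over `E[X]` into
one over `K[X]`; functionals separate points. -/
lemma PolyIndep.map {ι : Type*} [Fintype ι] {p : ι → PowerSeries K} (hp : PolyIndep p) :
    PolyIndep fun i => (p i).map (algebraMap K E) := by
  intro c hc
  funext i
  ext n
  rw [Pi.zero_apply, Polynomial.coeff_zero, ← Module.forall_dual_apply_eq_zero_iff K]
  intro ℓ
  set cl : ι → K[X] := fun i => ∑ m ∈ Finset.range ((c i).natDegree + 1),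
    monomial m (ℓ ((c i).coeff m)) with hcl
  have hcoeff : ∀ i m, (cl i).coeff m = ℓ ((c i).coeff m) := by
    intro i m
    simp only [hcl, Polynomial.finsetSum_coeff, Polynomial.coeff_monomial, Finset.sum_ite_eq',
      Finset.mem_range]
    split_ifs with h
    · rfl
    · rw [Polynomial.coeff_eq_zero_of_natDegree_lt (by omega), map_zero]
  have h0 := hp cl (by
    ext m
    have h1 := congrArg (fun s => ℓ (PowerSeries.coeff m s)) hc
    simp only [map_zero] at h1
    rw [map_zero, ← h1, map_sum, map_sum, map_sum]
    refine Finset.sum_congr rfl fun i _ => ?_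
    rw [PowerSeries.coeff_mul, PowerSeries.coeff_mul, map_sum]
    refine Finset.sum_congr rfl fun x _ => ?_
    rw [Polynomial.coeff_coe, Polynomial.coeff_coe, PowerSeries.coeff_map, hcoeff, mul_comm _
      (algebraMap K E _), ← Algebra.smul_def, map_smul, smul_eq_mul, mul_comm])
  rw [← hcoeff, h0]
  simp

lemma PolyIndep.rescale {ι : Type*} [Fintype ι] {p : ι → PowerSeries E} (hp : PolyIndep p) {η : E}
    (hη : η ≠ 0) : PolyIndep fun i => PowerSeries.rescale η (p i) := by
  intro c hc
  have hcoe : ∀ r : E[X], ((r.comp (C η⁻¹ * X) : E[X]) : PowerSeries E)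
      = PowerSeries.rescale η⁻¹ (r : PowerSeries E) := by
    intro r
    ext n
    rw [Polynomial.coeff_coe, Polynomial.comp_C_mul_X_coeff, PowerSeries.coeff_rescale,
      Polynomial.coeff_coe, mul_comm]
  have h0 := hp (fun i => (c i).comp (C η⁻¹ * X)) (by
    have h1 := congrArg (PowerSeries.rescale η⁻¹) hc
    rw [map_zero, map_sum] at h1
    rw [← h1]
    refine Finset.sum_congr rfl fun i _ => ?_
    rw [hcoe, map_mul, PowerSeries.rescale_rescale, mul_inv_cancel₀ hη, PowerSeries.rescale_one]
    rfl)
  funext i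
  ext n
  have h2 := congrArg (fun r : E[X] => r.coeff n) (congrFun h0 i)
  simp only [Polynomial.comp_C_mul_X_coeff, Pi.zero_apply, Polynomial.coeff_zero, mul_eq_zero] at h2
  exact h2.resolve_right (pow_ne_zero _ (inv_ne_zero hη))

lemma algebraicIndependent_pair_iff {a b : E} : AlgebraicIndependent K ![b, a] ↔
    Transcendental K a ∧ Transcendental (Algebra.adjoin K {a}) b := by
  have h1 := AlgebraicIndependent.option_iff (R := K) (x := ![a]) (a := b)
  rw [algebraicIndependent_iff_transcendental] at h1
  have hr : Set.range ![a] = {a} := by simp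
  rw [hr] at h1
  rw [← h1]
  exact (algebraicIndependent_equiv' (finSuccEquiv 1).symm (by
    funext o
    rcases o with _ | i
    · simp
    · fin_cases i; simp)).symm

lemma algebraicIndependent_pair_comm {a b : E} :
    AlgebraicIndependent K ![b, a] ↔ AlgebraicIndependent K ![a, b] :=
  (algebraicIndependent_equiv' (Equiv.swap 0 1) (by
    funext i
    fin_cases i <;> simp)).symm

lemma isAlgebraic_adjoin_of_relation {α β : E} (hα : Transcendental K α)
    {Q : MvPolynomial (Fin 2) K} (hQ : Q ≠ 0) (h : MvPolynomial.aeval ![α, β] Q = 0) :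
    IsAlgebraic (Algebra.adjoin K {α}) β := by
  by_contra hβ
  have := algebraicIndependent_pair_comm.1 (algebraicIndependent_pair_iff.2 ⟨hα, hβ⟩)
  exact hQ (this.eq_zero_of_aeval_eq_zero _ h)

lemma isAlgebraic_adjoin_exchange {α a : E} (ha : Transcendental K a)
    (h : IsAlgebraic (Algebra.adjoin K {α}) a) : IsAlgebraic (Algebra.adjoin K {a}) α := by
  by_contra hα
  have := algebraicIndependent_pair_comm.1 (algebraicIndependent_pair_iff.2 ⟨ha, hα⟩)
  exact (algebraicIndependent_pair_iff.1 this).2 h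

lemma isAlgebraic_adjoin_trans {α β w : E} (h : IsAlgebraic (Algebra.adjoin K {α}) β)
    (hw : IsAlgebraic (Algebra.adjoin K {β}) w) : IsAlgebraic (Algebra.adjoin K {α}) w :=
  hw.adjoin_of_forall_isAlgebraic (by
    rintro x ⟨hx, -⟩
    rwa [Set.mem_singleton_iff.1 hx])

lemma isAlgebraic_of_zpow {S : Type*} [CommRing S] [IsDomain S] [Algebra S E] {y : E} {k : ℤ}
    (hk : k ≠ 0) (h : IsAlgebraic S (y ^ k)) : IsAlgebraic S y := by
  have hn : 0 < k.natAbs := Int.natAbs_pos.2 hk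
  refine IsAlgebraic.of_pow hn ?_
  rcases Int.natAbs_eq k with h1 | h1
  · rw [h1, zpow_natCast] at h
    exact h
  · rw [h1, zpow_neg, zpow_natCast] at h
    simpa using h.inv

lemma isAlgebraic_of_isOfFinOrder (S : Type*) [CommRing S] [Nontrivial S] [Algebra S E] {ζ : E}
    (hζ : IsOfFinOrder ζ) : IsAlgebraic S ζ := by
  obtain ⟨n, hn, h1⟩ := isOfFinOrder_iff_pow_eq_one.1 hζ
  refine IsAlgebraic.of_pow hn ?_
  rw [h1]
  exact isAlgebraic_one

lemma isOfFinOrder_ne_zero {ζ : E} (hζ : IsOfFinOrder ζ) : ζ ≠ 0 := by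
  rintro rfl
  obtain ⟨n, hn, h1⟩ := isOfFinOrder_iff_pow_eq_one.1 hζ
  rw [zero_pow hn.ne'] at h1
  exact zero_ne_one h1

/-- Over the field of constants `K`, the points `ζ₁ a y ^ k₁` and `ζ₂ a y ^ k₂` are algebraically
independent when `a` and `y` are, so functions algebraic over them satisfy no relation. -/
theorem false_of_relation {a y α β ζ₁ ζ₂ : E} {k₁ k₂ : ℤ} (ha : Transcendental K a)
    (hy : Transcendental (Algebra.adjoin K {a}) y) (hk₁ : k₁ ≠ 0) (hk : k₁ ≠ k₂)
    (hζ₁ : IsOfFinOrder ζ₁) (hζ₂ : IsOfFinOrder ζ₂)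
    (hu : IsAlgebraic (Algebra.adjoin K {α}) (ζ₁ * a * y ^ k₁))
    (hw : IsAlgebraic (Algebra.adjoin K {β}) (ζ₂ * a * y ^ k₂))
    {Q : MvPolynomial (Fin 2) K} (hQ : Q ≠ 0) (h : MvPolynomial.aeval ![α, β] Q = 0) : False := by
  have ha0 : a ≠ 0 := fun h0 => ha (h0 ▸ isAlgebraic_zero)
  have hy0 : y ≠ 0 := fun h0 => hy (h0 ▸ isAlgebraic_zero)
  have haa : IsAlgebraic (Algebra.adjoin K {a}) a :=
    isAlgebraic_algebraMap (⟨a, Algebra.subset_adjoin rfl⟩ : Algebra.adjoin K {a})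
  have hdiv : ∀ {S : Type _} [CommRing S] [IsDomain S] [Algebra S E] {ζ : E} {k : ℤ},
      IsOfFinOrder ζ → IsAlgebraic S (ζ * a * y ^ k) → IsAlgebraic S (a * y ^ k) := by
    intro S _ _ _ ζ k hζ h
    have := (isAlgebraic_of_isOfFinOrder S hζ).inv.mul h
    rwa [mul_assoc, inv_mul_cancel_left₀ (isOfFinOrder_ne_zero hζ)] at this
  -- Otherwise `ζ₁ a y^k₁` would be algebraic over `K[a]`, and so would `y`.
  have hα : Transcendental K α := by
    intro hα
    have h1 : IsAlgebraic (Algebra.adjoin K {a}) α := hα.extendScalars (algebraMap K (Algebra.adjoin K {a})).injective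
    have h2 := hdiv hζ₁ (isAlgebraic_adjoin_trans h1 hu)
    have h3 := haa.inv.mul h2
    rw [inv_mul_cancel_left₀ ha0] at h3
    exact hy (isAlgebraic_of_zpow hk₁ h3)
  have hw' := hdiv hζ₂ (isAlgebraic_adjoin_trans (isAlgebraic_adjoin_of_relation hα hQ h) hw)
  have hu' := hdiv hζ₁ hu
  -- The quotient of the two points eliminates `a` and leaves `y^(k₁ - k₂)`. Thus `y`, then `a`, is
  -- algebraic over `K[α]`, and exchanging `α` for `a` contradicts `hy`.
  have hyα : IsAlgebraic (Algebra.adjoin K {α}) y := by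
    refine isAlgebraic_of_zpow (k := k₁ - k₂) (by omega) ?_
    have := hu'.mul hw'.inv
    rwa [show a * y ^ k₁ * (a * y ^ k₂)⁻¹ = y ^ (k₁ - k₂) by
      rw [zpow_sub₀ hy0]
      field_simp] at this
  have haα : IsAlgebraic (Algebra.adjoin K {α}) a := by
    have hyk : IsAlgebraic (Algebra.adjoin K {α}) (y ^ k₁) := by
      rcases Int.natAbs_eq k₁ with h1 | h1
      · rw [h1, zpow_natCast]; exact hyα.pow _
      · rw [h1, zpow_neg, zpow_natCast]; exact (hyα.pow _).inv
    have := hu'.mul hyk.inv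
    rwa [mul_assoc, mul_inv_cancel₀ (zpow_ne_zero _ hy0), mul_one] at this
  exact hy (isAlgebraic_adjoin_trans (isAlgebraic_adjoin_exchange ha haα) hyα)

lemma countable_isAlgebraic_adjoin [Countable K] (a : E) :
    {y : E | IsAlgebraic (Algebra.adjoin K {a}) y}.Countable := by
  have : Countable (Algebra.adjoin K {a}) := by
    rw [Algebra.adjoin_singleton_eq_range_aeval]
    have : Countable K[X] := by
      have := Polynomial.cardinalMk_le_max (R := K)
      exact Cardinal.mk_le_aleph0_iff.1 (this.trans (by simp))
    exact (Set.countable_range (aeval a)).to_subtype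
  exact Algebraic.countable _ E

end Algebraic

/-! ### From reciprocals of values to values -/

section Reversal

variable {K E : Type*} [Field K] [Field E] [Algebra K E]

/-- Reversing with exponents `M + 1 - s_i` instead of `M - s_i` makes every monomial divisible by
`XY`, so the new relation also holds where a value is zero. -/
lemma exists_reversed_relation {P : MvPolynomial (Fin 2) K} (hP : P ≠ 0) :
    ∃ Q : MvPolynomial (Fin 2) K, Q ≠ 0 ∧ ∀ α β : E,
      (α ≠ 0 → β ≠ 0 → MvPolynomial.aeval ![1 / α, 1 / β] P = 0) →
        MvPolynomial.aeval ![α, β] Q = 0 := by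
  set M := P.totalDegree
  have hM : ∀ s ∈ P.support, ∀ i, s i ≤ M := fun s hs i =>
    (MvPolynomial.degreeOf_le_iff.1 (MvPolynomial.degreeOf_le_totalDegree P i)) s hs
  let e : (Fin 2 →₀ ℕ) → (Fin 2 →₀ ℕ) := fun s => Finsupp.equivFunOnFinite.symm fun i => M + 1 - s i
  have he : ∀ s i, e s i = M + 1 - s i := fun s i => rfl
  refine ⟨∑ s ∈ P.support, MvPolynomial.monomial (e s) (P.coeff s), ?_, fun α β h => ?_⟩
  · obtain ⟨s₀, hs₀⟩ := MvPolynomial.support_nonempty.2 hP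
    intro h0
    have h1 := congrArg (MvPolynomial.coeff (e s₀)) h0
    rw [MvPolynomial.coeff_sum, Finset.sum_eq_single s₀] at h1
    · rw [MvPolynomial.coeff_monomial, if_pos rfl, MvPolynomial.coeff_zero] at h1
      exact MvPolynomial.mem_support_iff.1 hs₀ h1
    · intro s hs hne
      rw [MvPolynomial.coeff_monomial, if_neg]
      intro hes
      refine hne (Finsupp.ext fun i => ?_)
      have h2 := congrArg (fun t : Fin 2 →₀ ℕ => t i) hes
      simp only [he] at h2
      have := hM s hs i
      have := hM s₀ hs₀ i
      omega
    · exact fun h => absurd hs₀ h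
  · have hev : MvPolynomial.aeval ![α, β] (∑ s ∈ P.support,
        MvPolynomial.monomial (e s) (P.coeff s))
        = ∑ s ∈ P.support, algebraMap K E (P.coeff s) * (α ^ (M + 1 - s 0) * β ^ (M + 1 - s 1)) := by
      rw [map_sum]
      refine Finset.sum_congr rfl fun s _ => ?_
      rw [MvPolynomial.aeval_monomial, Finsupp.prod_fintype _ _ (by simp), Fin.prod_univ_two, he, he]
      simp
    rw [hev]
    by_cases hα : α = 0
    · refine Finset.sum_eq_zero fun s hs => ?_
      have := hM s hs 0
      rw [hα, zero_pow (by omega), zero_mul, mul_zero]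
    by_cases hβ : β = 0
    · refine Finset.sum_eq_zero fun s hs => ?_
      have := hM s hs 1
      rw [hβ, zero_pow (by omega), mul_zero, mul_zero]
    have h1 := h hα hβ
    rw [MvPolynomial.aeval_def, MvPolynomial.eval₂_eq'] at h1
    have h2 := congrArg (fun t => α ^ (M + 1) * β ^ (M + 1) * t) h1
    simp only [mul_zero, Finset.mul_sum] at h2
    rw [← h2]
    refine Finset.sum_congr rfl fun s hs => ?_
    have hs0 := hM s hs 0
    have hs1 := hM s hs 1
    rw [Fin.prod_univ_two]
    simp only [Matrix.cons_val_zero, Matrix.cons_val_one]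
    rw [pow_sub₀ α hα (by omega), pow_sub₀ β hβ (by omega), one_div, one_div, inv_pow, inv_pow]
    ring

lemma exists_mem_restrictDegree (Q : MvPolynomial (Fin 2) K) :
    ∃ D, Q ∈ MvPolynomial.restrictDegree (Fin 2) K D :=
  ⟨Q.totalDegree, mem_restrictDegree_iff_degreeOf.2 fun i =>
    MvPolynomial.degreeOf_le_totalDegree Q i⟩

/-- The coefficient of `X ^ i * Y ^ j`. -/
def coeffPair (Q : MvPolynomial (Fin 2) K) (i j : ℕ) : K :=
  Q.coeff (Finsupp.equivFunOnFinite.symm ![i, j])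

lemma aeval_eq_sum_coeffPair {D : ℕ} {Q : MvPolynomial (Fin 2) K}
    (hQ : Q ∈ MvPolynomial.restrictDegree (Fin 2) K D) (α β : E) :
    MvPolynomial.aeval ![α, β] Q = ∑ i : Fin (D + 1), ∑ j : Fin (D + 1),
      algebraMap K E (coeffPair Q i j) * (α ^ (i : ℕ) * β ^ (j : ℕ)) := by
  rw [MvPolynomial.aeval_def, MvPolynomial.eval₂_eq', ← Finset.sum_product']
  have hD := (MvPolynomial.mem_restrictDegree _ _ _).1 hQ
  have hself : ∀ s : Fin 2 →₀ ℕ, Finsupp.equivFunOnFinite.symm ![s 0, s 1] = s := by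
    intro s
    ext i
    fin_cases i <;> simp
  have hval : ∀ s ∈ Q.support, ∀ i, (Fin.ofNat (D + 1) (s i) : ℕ) = s i := fun s hs i =>
    Nat.mod_eq_of_lt (Nat.lt_succ_of_le (hD s hs i))
  refine Finset.sum_of_injOn
    (fun s : Fin 2 →₀ ℕ => (Fin.ofNat (D + 1) (s 0), Fin.ofNat (D + 1) (s 1))) ?_ ?_ ?_ ?_
  · intro s hs t ht hst
    rw [Prod.mk.injEq] at hst
    have h0 := congrArg Fin.val hst.1
    have h1 := congrArg Fin.val hst.2
    rw [hval s hs, hval t ht] at h0 h1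
    rw [← hself s, ← hself t, h0, h1]
  · intro s _
    simp
  · rintro ⟨i, j⟩ - hx
    have : coeffPair Q i j = 0 := by
      by_contra hne
      refine hx ⟨_, MvPolynomial.mem_support_iff.2 hne, ?_⟩
      simp
    simp [this]
  · intro s hs
    simp only [hval s hs, coeffPair, hself, Fin.prod_univ_two, Matrix.cons_val_zero,
      Matrix.cons_val_one]

lemma exists_coeffPair_ne_zero {D : ℕ} {Q : MvPolynomial (Fin 2) K} (hQ0 : Q ≠ 0)
    (hQ : Q ∈ MvPolynomial.restrictDegree (Fin 2) K D) :
    ∃ i j : Fin (D + 1), coeffPair Q i j ≠ 0 := by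
  obtain ⟨s, hs⟩ := MvPolynomial.support_nonempty.2 hQ0
  have hD := (MvPolynomial.mem_restrictDegree _ _ _).1 hQ s hs
  refine ⟨⟨s 0, Nat.lt_succ_of_le (hD 0)⟩, ⟨s 1, Nat.lt_succ_of_le (hD 1)⟩, ?_⟩
  have : Finsupp.equivFunOnFinite.symm ![s 0, s 1] = s := by
    ext i
    fin_cases i <;> simp
  simp only [coeffPair]
  rw [this]
  exact MvPolynomial.mem_support_iff.1 hs

end Reversal

/-! ### Transport of relations along `a ↦ a^(d^m)` -/

section Relations

variable {K E : Type*} [Field K] [NormedField E] [Algebra K E]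

/-- The power series `g` converges on the punctured disc `Δ`, with sum `z * ψ z`. -/
structure RegularEval (g : PowerSeries K) (Δ : Set E) (ψ : E → E) : Prop where
  ne_zero : ∀ z ∈ Δ, z ≠ 0
  mem_of_norm_le : ∀ z ∈ Δ, ∀ z', z' ≠ 0 → ‖z'‖ ≤ ‖z‖ → z' ∈ Δ
  exists_norm_lt : ∀ z ∈ Δ, ∃ z' ∈ Δ, ‖z‖ < ‖z'‖
  mem_evalSubring : ∀ z ∈ Δ, (g.map (algebraMap K E), z * ψ z) ∈ evalSubring z

variable {g : PowerSeries K} {Δ : Set E} {ψ : E → E}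

lemma RegularEval.mem_of_norm_eq_one (h : RegularEval g Δ ψ) {a ζ y : E} (ha : a ∈ Δ)
    (hζ : ‖ζ‖ = 1) (hy : ‖y‖ = 1) (k : ℤ) : ζ * a * y ^ k ∈ Δ := by
  have hζ0 : ζ ≠ 0 := norm_ne_zero_iff.1 (by rw [hζ]; exact one_ne_zero)
  have hy0 : y ≠ 0 := norm_ne_zero_iff.1 (by rw [hy]; exact one_ne_zero)
  refine h.mem_of_norm_le a ha _
    (mul_ne_zero (mul_ne_zero hζ0 (h.ne_zero a ha)) (zpow_ne_zero _ hy0)) ?_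
  simp [hζ, hy]

lemma RegularEval.pow_mem (h : RegularEval g Δ ψ) {z : E} (hz : z ∈ Δ) (hz1 : ‖z‖ ≤ 1) {n : ℕ}
    (hn : n ≠ 0) : z ^ n ∈ Δ := by
  refine h.mem_of_norm_le z hz _ (pow_ne_zero _ (h.ne_zero z hz)) ?_
  rw [norm_pow]
  exact pow_le_of_le_one (norm_nonneg z) hz1 hn

lemma RegularEval.aeval_iterate (h : RegularEval g Δ ψ) {f : K[X]} (hd : f.natDegree ≠ 0)
    (hg : defect f hd g = 0) {z : E} (hz : z ∈ Δ) (hz1 : ‖z‖ ≤ 1) (n : ℕ) :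
    aeval (ψ z) (f.comp^[n] X) = ψ (z ^ f.natDegree ^ n) := by
  induction n with
  | zero => simp
  | succ n ih =>
    have hmem := h.pow_mem hz hz1 (pow_ne_zero n hd)
    have hnorm : ‖z ^ f.natDegree ^ n‖ ≤ 1 := by
      rw [norm_pow]
      exact pow_le_one₀ (norm_nonneg z) hz1
    rw [Function.iterate_succ_apply', Polynomial.aeval_comp, ih, pow_succ, pow_mul]
    exact aeval_eq_of_defect_eq_zero hd hg (h.ne_zero _ hmem) (h.mem_evalSubring _ hmem)
      (h.mem_evalSubring _ (h.pow_mem hmem hnorm hd))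

/-- A polynomial relation of degree at most `D` in each variable between the values
`ψ (ζ₁ a y ^ k₁)` and `ψ (ζ₂ a y ^ k₂)`, valid on the unit circle. -/
def HasRelation (K : Type*) [Field K] [Algebra K E] (ψ : E → E) (k₁ k₂ : ℤ) (D : ℕ)
    (ζ₁ ζ₂ a : E) : Prop :=
  ∃ Q : MvPolynomial (Fin 2) K, Q ≠ 0 ∧ Q ∈ MvPolynomial.restrictDegree (Fin 2) K D ∧
    ∀ y : E, ‖y‖ = 1 → MvPolynomial.aeval ![ψ (ζ₁ * a * y ^ k₁), ψ (ζ₂ * a * y ^ k₂)] Q = 0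

variable [IsAlgClosed E] {k₁ k₂ : ℤ}

/-- The dimension count is applied on the unit circle with `π(y) = y^N`, `N = d^m`, and `F` the
`m`-th iterate of `f`, of degree `N`. -/
lemma RegularEval.hasRelation_pow (h : RegularEval g Δ ψ) {f : K[X]} (hd : f.natDegree ≠ 0)
    (hg : defect f hd g = 0) {ζ₁ ζ₂ a : E} (ha : a ∈ Δ) (ha1 : ‖a‖ ≤ 1) (hζ₁ : ‖ζ₁‖ = 1)
    (hζ₂ : ‖ζ₂‖ = 1) {D₀ D n m : ℕ} (hrel : HasRelation K ψ k₁ k₂ D₀ ζ₁ ζ₂ a)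
    (hfib : ∀ x : E, ‖x‖ = 1 → ∃ ξ : Fin n → E,
      (∀ j, ‖ξ j‖ = 1 ∧ ξ j ^ f.natDegree ^ m = x ^ f.natDegree ^ m) ∧
      Function.Injective fun j => ψ (ζ₁ * a * ξ j ^ k₁)) (hn : n ≤ f.natDegree ^ m)
    (hcount : 2 * D₀ * (f.natDegree ^ m * (D + 1) + 1) < (D + 1) ^ 2 * n) :
    HasRelation K ψ k₁ k₂ D (ζ₁ ^ f.natDegree ^ m) (ζ₂ ^ f.natDegree ^ m)
      (a ^ f.natDegree ^ m) := by
  obtain ⟨Q, hQ0, hQ, hvan⟩ := hrel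
  set N := f.natDegree ^ m with hN
  have hN0 : N ≠ 0 := pow_ne_zero _ hd
  have hiter : ∀ {ζ : E} (k : ℤ), ‖ζ‖ = 1 → ∀ x : {y : E // ‖y‖ = 1},
      ψ (ζ ^ N * a ^ N * (x.1 ^ N) ^ k) = aeval (ψ (ζ * a * x.1 ^ k)) (f.comp^[m] X) := by
    intro ζ k hζ x
    rw [h.aeval_iterate hd hg (h.mem_of_norm_eq_one ha hζ x.2 k) (by simpa [hζ, x.2] using ha1),
      ← hN, mul_pow, mul_pow]
    congr 2
    rw [← zpow_natCast, ← zpow_natCast, ← zpow_mul, ← zpow_mul, mul_comm]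
  obtain ⟨Q', hQ'0, hQ', hvan'⟩ := exists_relation_of_fibres (K := K) (T := {y : E // ‖y‖ = 1})
    (A := fun x => ψ (ζ₁ * a * x.1 ^ k₁)) (B := fun x => ψ (ζ₂ * a * x.1 ^ k₂))
    (h₁ := fun y => ψ (ζ₁ ^ N * a ^ N * y.1 ^ k₁)) (h₂ := fun y => ψ (ζ₂ ^ N * a ^ N * y.1 ^ k₂))
    (π := fun x => ⟨x.1 ^ N, by rw [norm_pow, x.2, one_pow]⟩) (F := f.comp^[m] X) (N := N) (n := n)
    (D := D) (D₀ := D₀)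
    (by
      rintro ⟨y, hy⟩
      obtain ⟨x, hx⟩ := IsAlgClosed.exists_pow_nat_eq y (Nat.pos_of_ne_zero hN0)
      have hx1 : ‖x‖ ^ N = 1 := by rw [← norm_pow, hx, hy]
      exact ⟨⟨x, (pow_eq_one_iff_of_nonneg (norm_nonneg x) hN0).1 hx1⟩, Subtype.ext hx⟩)
    (by rw [Polynomial.natDegree_iterate_comp, Polynomial.natDegree_X, mul_one])
    (hiter k₁ hζ₁) (hiter k₂ hζ₂) hQ0 hQ (fun x => hvan x.1 x.2)
    (by
      rintro ⟨x, hx⟩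
      obtain ⟨ξ, h1, h2⟩ := hfib x hx
      exact ⟨fun j => ⟨ξ j, (h1 j).1⟩, fun j => Subtype.ext (h1 j).2, h2⟩)
    hn hcount
  exact ⟨Q', hQ'0, hQ', fun y hy => hvan' ⟨y, hy⟩⟩

/-- With one point per fibre no injectivity is needed, but the degree grows with `m`. This serves
only to reach a circle on which `ψ` is injective. -/
lemma RegularEval.exists_hasRelation_pow (h : RegularEval g Δ ψ) {f : K[X]}
    (hd : f.natDegree ≠ 0) (hg : defect f hd g = 0) {ζ₁ ζ₂ a : E} (ha : a ∈ Δ) (ha1 : ‖a‖ ≤ 1)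
    (hζ₁ : ‖ζ₁‖ = 1) (hζ₂ : ‖ζ₂‖ = 1) {D₀ : ℕ} (hrel : HasRelation K ψ k₁ k₂ D₀ ζ₁ ζ₂ a) (m : ℕ) :
    ∃ D, HasRelation K ψ k₁ k₂ D (ζ₁ ^ f.natDegree ^ m) (ζ₂ ^ f.natDegree ^ m)
      (a ^ f.natDegree ^ m) := by
  refine ⟨2 * D₀ * f.natDegree ^ m + 2 * D₀, h.hasRelation_pow hd hg ha ha1 hζ₁ hζ₂ hrel (n := 1)
    (fun x hx => ⟨fun _ => x, fun _ => ⟨hx, rfl⟩, Function.injective_of_subsingleton _⟩)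
    (Nat.one_le_iff_ne_zero.2 (pow_ne_zero _ hd)) ?_⟩
  nlinarith [Nat.zero_le (2 * D₀ * f.natDegree ^ m), Nat.zero_le D₀]

/-- The values of `ψ` on the circle of radius `r` are pairwise distinct. -/
def InjOnCircle (ψ : E → E) (r : ℝ) : Prop :=
  ∀ u w : E, ‖u‖ = r → ‖w‖ = r → ψ u = ψ w → u = w

/-- The degree bound is independent of `m`: by injectivity `ψ` takes at least `N/|k₁|` distinct
values on a fibre of `y ↦ y^N`, so `N` cancels from the count. -/
lemma RegularEval.hasRelation_pow_of_injOnCircle [CharZero E] (h : RegularEval g Δ ψ) {f : K[X]}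
    (hd : f.natDegree ≠ 0) (hg : defect f hd g = 0) {ζ₁ ζ₂ a : E} (ha : a ∈ Δ) (ha1 : ‖a‖ ≤ 1)
    (hζ₁ : ‖ζ₁‖ = 1) (hζ₂ : ‖ζ₂‖ = 1) (hk₁ : k₁ ≠ 0) (hinj : InjOnCircle ψ ‖a‖) {D₀ : ℕ}
    (hrel : HasRelation K ψ k₁ k₂ D₀ ζ₁ ζ₂ a) (m : ℕ) :
    HasRelation K ψ k₁ k₂ (4 * (D₀ * k₁.natAbs)) (ζ₁ ^ f.natDegree ^ m) (ζ₂ ^ f.natDegree ^ m)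
      (a ^ f.natDegree ^ m) := by
  set N := f.natDegree ^ m with hN
  have hN0 : N ≠ 0 := pow_ne_zero _ hd
  have hκ : 0 < k₁.natAbs := Int.natAbs_pos.2 hk₁
  -- Take `n = ⌈N/|k₁|⌉`. For a primitive `N`-th root of unity `ω`, the powers `ω^(j k₁)` with `j <
  -- n` are distinct.
  obtain ⟨n, hn1, hn2⟩ : ∃ n, N ≤ n * k₁.natAbs ∧ ∀ j < n, j * k₁.natAbs < N := by
    refine ⟨(N + k₁.natAbs - 1) / k₁.natAbs, ?_, fun j hj => ?_⟩
    · have := Nat.div_add_mod (N + k₁.natAbs - 1) k₁.natAbs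
      have h2 := Nat.mod_lt (N + k₁.natAbs - 1) hκ
      rw [mul_comm]
      omega
    · have := (Nat.le_div_iff_mul_le hκ).1 (Nat.succ_le_of_lt hj)
      rw [Nat.succ_mul] at this
      omega
  have hnpos : 0 < n := by
    rcases Nat.eq_zero_or_pos n with rfl | h0
    · omega
    · exact h0
  have hζ0 : ζ₁ ≠ 0 := norm_ne_zero_iff.1 (by rw [hζ₁]; exact one_ne_zero)
  refine h.hasRelation_pow hd hg ha ha1 hζ₁ hζ₂ hrel (n := n) (fun x hx => ?_) ?_ ?_
  · have : NeZero N := ⟨hN0⟩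
    obtain ⟨ω, hω⟩ := HasEnoughRootsOfUnity.exists_primitiveRoot E N
    have hω1 : ‖ω‖ = 1 := IsOfFinOrder.norm_eq_one
      (isOfFinOrder_iff_pow_eq_one.2 ⟨N, Nat.pos_of_ne_zero hN0, hω.pow_eq_one⟩)
    have hω0 : ω ≠ 0 := norm_ne_zero_iff.1 (by rw [hω1]; exact one_ne_zero)
    have hx0 : x ≠ 0 := norm_ne_zero_iff.1 (by rw [hx]; exact one_ne_zero)
    refine ⟨fun j => ω ^ (j : ℕ) * x, fun j => ⟨by simp [hω1, hx], ?_⟩, fun i j hij => ?_⟩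
    · rw [mul_pow, ← pow_mul, mul_comm (j : ℕ), pow_mul, hω.pow_eq_one, one_pow, one_mul]
    · have h1 := hinj _ _ (by simp [hω1, hx, hζ₁]) (by simp [hω1, hx, hζ₁]) hij
      have h2 := mul_left_cancel₀ (mul_ne_zero hζ0 (h.ne_zero a ha)) h1
      rw [mul_zpow, mul_zpow] at h2
      have h3 := mul_right_cancel₀ (zpow_ne_zero _ hx0) h2
      rw [← zpow_natCast, ← zpow_natCast, ← zpow_mul, ← zpow_mul] at h3
      have h4 : ω ^ ((i : ℤ) * k₁ - (j : ℤ) * k₁) = 1 := by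
        rw [zpow_sub₀ hω0, h3, div_self (zpow_ne_zero _ hω0)]
      rw [hω.zpow_eq_one_iff_dvd, ← sub_mul] at h4
      have h5 := Int.natAbs_dvd_natAbs.2 h4
      rw [Int.natAbs_natCast, Int.natAbs_mul] at h5
      have h6 : ((i : ℤ) - j).natAbs < n := by have := i.2; have := j.2; omega
      have h7 := Nat.eq_zero_of_dvd_of_lt h5 (hn2 _ h6)
      have h8 := (Nat.mul_eq_zero.1 h7).resolve_right hκ.ne'
      exact Fin.ext (by omega)
  · have := hn2 (n - 1) (by omega)
    have h2 : n - 1 ≤ (n - 1) * k₁.natAbs := Nat.le_mul_of_pos_right _ hκ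
    omega
  · set s := D₀ * k₁.natAbs with hs
    have hNpos : 1 ≤ N := Nat.one_le_iff_ne_zero.2 hN0
    calc 2 * D₀ * (N * (4 * s + 1) + 1) ≤ 2 * D₀ * (N * (4 * s + 2)) := by
          refine Nat.mul_le_mul_left _ ?_
          nlinarith
      _ ≤ 2 * D₀ * (n * k₁.natAbs * (4 * s + 2)) :=
          Nat.mul_le_mul_left _ (Nat.mul_le_mul_right _ hn1)
      _ = 2 * s * (4 * s + 2) * n := by rw [hs]; ring
      _ < (4 * s + 1) ^ 2 * n := Nat.mul_lt_mul_of_pos_right (by nlinarith) hnpos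

end Relations

/-! ### From relations of bounded degree to algebraicity -/

section Dependence

variable {K E : Type*} [Field K] [NormedField E] [Algebra K E]

lemma det_mem_evalSubring {n : ℕ} {z : E} {M : Matrix (Fin n) (Fin n) (PowerSeries E)}
    {V : Matrix (Fin n) (Fin n) E} (h : ∀ i j, (M i j, V i j) ∈ evalSubring z) :
    (M.det, V.det) ∈ evalSubring z := by
  let W : Matrix (Fin n) (Fin n) (evalSubring z) := Matrix.of fun i j => ⟨(M i j, V i j), h i j⟩
  have h1 := RingHom.map_det ((RingHom.fst _ _).comp (evalSubring z).subtype) W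
  have h2 := RingHom.map_det ((RingHom.snd _ _).comp (evalSubring z).subtype) W
  have h3 : W.det.1 = (M.det, V.det) := Prod.ext h1 h2
  rw [← h3]
  exact W.det.2

/-- The power series `X ^ (D - i) * g ^ i` for `i ≤ D`. -/
def homogPowers (D : ℕ) (g : PowerSeries K) (i : Fin (D + 1)) : PowerSeries K :=
  PowerSeries.X ^ (D - (i : ℕ)) * g ^ (i : ℕ)

variable {g : PowerSeries K} {Δ : Set E} {ψ : E → E}

lemma RegularEval.homogPowers_mem (h : RegularEval g Δ ψ) {u : E} (hu : u ∈ Δ) (D : ℕ)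
    (i : Fin (D + 1)) :
    ((homogPowers D g i).map (algebraMap K E), u ^ D * ψ u ^ (i : ℕ)) ∈ evalSubring u := by
  have h1 := mul_mem (_root_.pow_mem (X_mem_evalSubring u) (D - (i : ℕ)))
    (_root_.pow_mem (h.mem_evalSubring u hu) (i : ℕ))
  have h2 : u ^ D * ψ u ^ (i : ℕ) = u ^ (D - (i : ℕ)) * (u * ψ u) ^ (i : ℕ) := by
    rw [mul_pow, ← mul_assoc, ← pow_add, Nat.sub_add_cancel (Nat.lt_succ_iff.1 i.2)]
  rw [homogPowers, map_mul, map_pow, map_pow, PowerSeries.map_X, h2]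
  exact h1

/-- Freezing the roots of unity along infinitely many `m` lets one power series vanish at all the
corresponding points. -/
lemma exists_infinite_pow_eq {ζ₁ ζ₂ : E} (hζ₁ : IsOfFinOrder ζ₁) (hζ₂ : IsOfFinOrder ζ₂)
    (N : ℕ → ℕ) : ∃ η₁ η₂ : E, IsOfFinOrder η₁ ∧ IsOfFinOrder η₂ ∧
      {m | ζ₁ ^ N m = η₁ ∧ ζ₂ ^ N m = η₂}.Infinite := by
  have : Finite (Submonoid.powers ζ₁) := hζ₁.finite_powers
  have : Finite (Submonoid.powers ζ₂) := hζ₂.finite_powers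
  obtain ⟨⟨⟨η₁, n₁, h₁⟩, ⟨η₂, n₂, h₂⟩⟩, hinf⟩ := Finite.exists_infinite_fiber
    (fun m : ℕ => ((⟨ζ₁ ^ N m, N m, rfl⟩, ⟨ζ₂ ^ N m, N m, rfl⟩) :
      Submonoid.powers ζ₁ × Submonoid.powers ζ₂))
  refine ⟨η₁, η₂, h₁ ▸ hζ₁.pow, h₂ ▸ hζ₂.pow, ?_⟩
  refine (Set.infinite_coe_iff.1 hinf).mono fun m hm => ?_
  simp only [Set.mem_preimage, Set.mem_singleton_iff, Prod.mk.injEq] at hm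
  exact ⟨congrArg Subtype.val hm.1, congrArg Subtype.val hm.2⟩

variable {k₁ k₂ : ℤ}

/-- Relations of fixed degree at points tending to `0` have varying coefficients. Determinants
eliminate these coefficients and produce a single formal relation. -/
lemma RegularEval.not_polyIndep (h : RegularEval g Δ ψ) {ζ₁ ζ₂ a : E}
    (hζ₁ : IsOfFinOrder ζ₁) (hζ₂ : IsOfFinOrder ζ₂) (ha : a ∈ Δ) (ha1 : ‖a‖ < 1) (hk₁ : k₁ ≠ 0)
    (hk₂ : k₂ ≠ 0) (hk : k₁ ≠ k₂) (hinf : {y : E | ‖y‖ = 1}.Infinite) {d D : ℕ} (hd : 2 ≤ d)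
    (hrel : ∀ m : ℕ, HasRelation K ψ k₁ k₂ D (ζ₁ ^ d ^ m) (ζ₂ ^ d ^ m) (a ^ d ^ m)) :
    ¬ PolyIndep (homogPowers D g) := by
  intro hind
  obtain ⟨η₁, η₂, hη₁, hη₂, hI⟩ := exists_infinite_pow_eq hζ₁ hζ₂ fun m => d ^ m
  set p : Fin (D + 1) → PowerSeries E := fun i => (homogPowers D g i).map (algebraMap K E) with hp
  have hp1 := (hind.map (E := E)).rescale (isOfFinOrder_ne_zero hη₁)
  have hp2 := (hind.map (E := E)).rescale (isOfFinOrder_ne_zero hη₂)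
  let e := (finProdFinEquiv (m := D + 1) (n := D + 1)).symm
  let v : Fin ((D + 1) * (D + 1)) → {y : E // ‖y‖ = 1} → PowerSeries E := fun t y =>
    PowerSeries.rescale (y.1 ^ k₁) (PowerSeries.rescale η₁ (p (e t).1))
      * PowerSeries.rescale (y.1 ^ k₂) (PowerSeries.rescale η₂ (p (e t).2))
  have hdet : ∀ y : Fin ((D + 1) * (D + 1)) → {y : E // ‖y‖ = 1},
      (Matrix.of fun i j => v i (y j)).det = 0 := by
    intro y
    refine eq_zero_of_accumulating_zeros fun ε hε => ?_
    obtain ⟨m₀, hm₀⟩ := exists_pow_lt_of_lt_one hε ha1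
    obtain ⟨m, ⟨hm1, hm2⟩, hm⟩ := hI.exists_gt m₀
    set c := a ^ d ^ m with hc
    have hcΔ : c ∈ Δ := h.pow_mem ha ha1.le (pow_ne_zero _ (by omega))
    have hcε : ‖c‖ < ε := by
      rw [hc, norm_pow]
      refine lt_of_le_of_lt (pow_le_pow_of_le_one (norm_nonneg a) ha1.le ?_) hm₀
      exact hm.le.trans (Nat.lt_pow_self (by omega)).le
    refine ⟨c, h.ne_zero c hcΔ, hcε, ?_⟩
    obtain ⟨Q, hQ0, hQ, hvan⟩ := hrel m
    rw [hm1, hm2, ← hc] at hvan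
    have hη₁1 := hη₁.norm_eq_one
    have hη₂1 := hη₂.norm_eq_one
    let u : {y : E // ‖y‖ = 1} → E := fun y => η₁ * c * y.1 ^ k₁
    let w : {y : E // ‖y‖ = 1} → E := fun y => η₂ * c * y.1 ^ k₂
    have hmem := det_mem_evalSubring (z := c) (M := Matrix.of fun i j => v i (y j))
      (V := Matrix.of fun t j => (u (y j) ^ D * ψ (u (y j)) ^ ((e t).1 : ℕ))
        * (w (y j) ^ D * ψ (w (y j)) ^ ((e t).2 : ℕ))) (fun t j => by
        have h1 := h.homogPowers_mem (h.mem_of_norm_eq_one hcΔ hη₁1 (y j).2 k₁) D (e t).1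
        have h2 := h.homogPowers_mem (h.mem_of_norm_eq_one hcΔ hη₂1 (y j).2 k₂) D (e t).2
        rw [show η₁ * c * (y j).1 ^ k₁ = η₁ * ((y j).1 ^ k₁ * c) by ring] at h1
        rw [show η₂ * c * (y j).1 ^ k₂ = η₂ * ((y j).1 ^ k₂ * c) by ring] at h2
        have h3 := mul_mem (rescale_mem_evalSubring (rescale_mem_evalSubring h1))
          (rescale_mem_evalSubring (rescale_mem_evalSubring h2))
        convert h3 using 1
        refine Prod.ext rfl ?_
        simp only [Matrix.of_apply, u, w, Prod.snd_mul]
        rw [show η₁ * c * (y j).1 ^ k₁ = η₁ * ((y j).1 ^ k₁ * c) by ring,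
          show η₂ * c * (y j).1 ^ k₂ = η₂ * ((y j).1 ^ k₂ * c) by ring])
    -- The coefficients of `Q` give a non-zero left kernel vector; the common factor `u^D w^D` only
    -- clears poles.
    have hV : (Matrix.of fun t j => (u (y j) ^ D * ψ (u (y j)) ^ ((e t).1 : ℕ))
        * (w (y j) ^ D * ψ (w (y j)) ^ ((e t).2 : ℕ))).det = 0 := by
      rw [← Matrix.exists_vecMul_eq_zero_iff]
      refine ⟨fun t => algebraMap K E (coeffPair Q (e t).1 (e t).2), fun h0 => ?_, ?_⟩
      · obtain ⟨i, j, hij⟩ := exists_coeffPair_ne_zero hQ0 hQ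
        have := congrFun h0 (e.symm (i, j))
        simp only [Equiv.apply_symm_apply, Pi.zero_apply, map_eq_zero] at this
        exact hij this
      · funext j
        have h1 := hvan (y j).1 (y j).2
        rw [aeval_eq_sum_coeffPair hQ, ← Finset.sum_product', Finset.univ_product_univ,
          ← Equiv.sum_comp e] at h1
        simp only [Matrix.vecMul, dotProduct, Matrix.of_apply, Pi.zero_apply]
        have h2 := congrArg (fun s => u (y j) ^ D * w (y j) ^ D * s) h1
        simp only [mul_zero, Finset.mul_sum] at h2
        rw [← h2]
        refine Finset.sum_congr rfl fun t _ => ?_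
        simp only [u, w]
        ring
    rwa [hV] at hmem
  obtain ⟨φ, hφ0, hφ⟩ := exists_relation_of_det_eq_zero v hdet
  have hzero := eq_zero_of_forall_rescale (φ := fun i j => φ (e.symm (i, j))) hp1 hp2 hk₁ hk₂ hk
    hinf (fun y hy => norm_ne_zero_iff.1 (by rw [hy]; exact one_ne_zero))
    (fun y hy => by
      rw [Set.mem_ofPred_eq] at hy ⊢
      rw [norm_inv, hy, inv_one]) (fun y hy => by
      rw [← hφ ⟨y, hy⟩, ← Equiv.sum_comp e.symm, ← Finset.sum_product', Finset.univ_product_univ]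
      refine Finset.sum_congr rfl fun x _ => ?_
      simp only [v, Equiv.apply_symm_apply]
      rfl)
  refine hφ0 (funext fun t => ?_)
  have := congrFun (congrFun hzero (e t).1) (e t).2
  simpa using this

/-- The polynomial `∑ i, r i (Y) * X ^ i`. -/
def bivariateSum {D : ℕ} (r : Fin (D + 1) → K[X]) : MvPolynomial (Fin 2) K :=
  ∑ i : Fin (D + 1), MvPolynomial.X 0 ^ (i : ℕ)
    * aeval (MvPolynomial.X 1 : MvPolynomial (Fin 2) K) (r i)

lemma aeval_bivariateSum {D : ℕ} (r : Fin (D + 1) → K[X]) {S : Type*} [CommRing S] [Algebra K S]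
    (x y : S) : MvPolynomial.aeval ![x, y] (bivariateSum r)
      = ∑ i : Fin (D + 1), x ^ (i : ℕ) * aeval y (r i) := by
  rw [bivariateSum, map_sum]
  refine Finset.sum_congr rfl fun i _ => ?_
  rw [map_mul, map_pow, MvPolynomial.aeval_X, ← Polynomial.aeval_algHom_apply,
    MvPolynomial.aeval_X]
  simp

/-- A dependence of the `X^(D-i) g^i` over `K[X]`, evaluated at `u` and divided by `u^D`, is a
non-zero polynomial relation between `ψ u` and `u`. -/
lemma RegularEval.isAlgebraic_of_not_polyIndep (h : RegularEval g Δ ψ) {D : ℕ}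
    (hind : ¬ PolyIndep (homogPowers D g)) {u : E} (hu : u ∈ Δ) (hψ : Transcendental K (ψ u)) :
    IsAlgebraic (Algebra.adjoin K {ψ u}) u := by
  simp only [PolyIndep] at hind
  push Not at hind
  obtain ⟨r, hr, hr0⟩ := hind
  have hR0 : bivariateSum r ≠ 0 := by
    intro h0
    refine hr0 (funext fun i => ?_)
    have h1 := aeval_bivariateSum r (X : K[X][X]) (C X)
    rw [h0, map_zero] at h1
    have h2 := congrArg (fun q : K[X][X] => q.coeff i) h1
    have h3 : ∀ i, aeval (C X : K[X][X]) (r i) = C (r i) := fun i => by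
      rw [← Polynomial.algebraMap_eq (R := K[X]), Polynomial.aeval_algebraMap_apply,
        Polynomial.aeval_X_left_apply]
    simp only [Polynomial.coeff_zero, Polynomial.finsetSum_coeff, h3, mul_comm (X ^ _),
      Polynomial.coeff_C_mul, Polynomial.coeff_X_pow] at h2
    rw [Finset.sum_eq_single i] at h2
    · simpa using h2.symm
    · intro j _ hj
      rw [if_neg fun hij => hj (Fin.ext hij.symm), mul_zero]
    · exact fun hi => absurd (Finset.mem_univ i) hi
  refine isAlgebraic_adjoin_of_relation hψ hR0 ?_
  have hmem : ((0 : PowerSeries E), ∑ i : Fin (D + 1), aeval u (r i) * (u ^ D * ψ u ^ (i : ℕ)))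
      ∈ evalSubring u := by
    have h1 := Subring.sum_mem (evalSubring u) (t := Finset.univ)
      (f := fun i : Fin (D + 1) => ((((r i).map (algebraMap K E) : E[X]) : PowerSeries E),
        ((r i).map (algebraMap K E)).eval u)
        * ((homogPowers D g i).map (algebraMap K E), u ^ D * ψ u ^ (i : ℕ)))
      fun i _ => mul_mem (polynomial_mem_evalSubring u _) (h.homogPowers_mem hu D i)
    convert h1 using 1
    refine Prod.ext ?_ ?_
    · rw [Prod.fst_sum]
      have h2 := congrArg (PowerSeries.map (algebraMap K E)) hr
      rw [map_zero, map_sum] at h2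
      refine h2.symm.trans (Finset.sum_congr rfl fun i _ => ?_)
      rw [map_mul, Prod.fst_mul, Polynomial.polynomial_map_coe]
    · rw [Prod.snd_sum]
      show ∑ i : Fin (D + 1), aeval u (r i) * (u ^ D * ψ u ^ (i : ℕ)) = _
      refine Finset.sum_congr rfl fun i _ => ?_
      rw [Prod.snd_mul, Polynomial.eval_map_algebraMap]
  have h3 := evalSubring_unique hmem (zero_mem (evalSubring u))
  refine (mul_eq_zero.1 (?_ : u ^ D * _ = 0)).resolve_left (pow_ne_zero D (h.ne_zero u hu))
  rw [aeval_bivariateSum, Finset.mul_sum, ← h3]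
  refine Finset.sum_congr rfl fun i _ => ?_
  ring

/-- `u` is a root of `p - ψ(u) X`, which is non-zero since `p(0) = 1`. -/
lemma RegularEval.isAlgebraic_of_polynomial (h : RegularEval g Δ ψ)
    (hg1 : PowerSeries.constantCoeff g = 1) {p : K[X]} (hp : g = p) {u : E} (hu : u ∈ Δ) :
    IsAlgebraic (Algebra.adjoin K {ψ u}) u := by
  have h1 := h.mem_evalSubring u hu
  rw [hp, ← Polynomial.polynomial_map_coe] at h1
  have h2 := evalSubring_unique h1 (polynomial_mem_evalSubring u (p.map (algebraMap K E)))
  let α : Algebra.adjoin K {ψ u} := ⟨ψ u, Algebra.subset_adjoin rfl⟩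
  refine ⟨p.map (algebraMap K (Algebra.adjoin K {ψ u})) - C α * X, fun h0 => ?_, ?_⟩
  · have h3 := congrArg (fun q => Polynomial.coeff q 0) h0
    have h4 : p.coeff 0 = 1 := by
      rw [← Polynomial.coeff_coe, ← hp, PowerSeries.coeff_zero_eq_constantCoeff_apply, hg1]
    simp [h4] at h3
  · rw [map_sub, map_mul, Polynomial.aeval_C, Polynomial.aeval_X, Polynomial.aeval_map_algebraMap,
      ← Polynomial.eval_map_algebraMap, ← h2]
    show u * ψ u - ψ u * u = 0
    ring

lemma finite_zpow_eq {k : ℤ} (hk : k ≠ 0) (c : E) : {y : E | y ^ k = c}.Finite := by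
  have hn : 0 < k.natAbs := Int.natAbs_pos.2 hk
  have hfin : ∀ c : E, {y : E | y ^ k.natAbs = c}.Finite := fun c =>
    ((nthRoots k.natAbs c).finite_toSet).subset fun y hy => (mem_nthRoots hn).2 hy
  rcases Int.natAbs_eq k with h1 | h1
  · refine (hfin c).subset fun y hy => ?_
    rw [Set.mem_ofPred_eq, h1, zpow_natCast] at hy
    exact hy
  · refine (hfin c⁻¹).subset fun y hy => ?_
    rw [Set.mem_ofPred_eq, h1, zpow_neg, zpow_natCast] at hy
    rw [Set.mem_ofPred_eq, ← hy, inv_inv]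

/-- There are countably many algebraic values, and by injectivity each is attained for only finitely
many `y`. -/
lemma countable_isAlgebraic_value [Countable K] {ζ a : E} (hζ : ‖ζ‖ = 1) (ha : a ≠ 0)
    (hinj : InjOnCircle ψ ‖a‖) {k : ℤ} (hk : k ≠ 0) :
    {y : E | ‖y‖ = 1 ∧ IsAlgebraic K (ψ (ζ * a * y ^ k))}.Countable := by
  have hζ0 : ζ ≠ 0 := norm_ne_zero_iff.1 (by rw [hζ]; exact one_ne_zero)
  have hsub : {y : E | ‖y‖ = 1 ∧ IsAlgebraic K (ψ (ζ * a * y ^ k))} ⊆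
      ⋃ α ∈ {α : E | IsAlgebraic K α}, {y : E | ‖y‖ = 1 ∧ ψ (ζ * a * y ^ k) = α} := by
    rintro y ⟨hy, hα⟩
    exact Set.mem_biUnion (x := ψ (ζ * a * y ^ k)) hα ⟨hy, rfl⟩
  refine (Set.Countable.biUnion (Algebraic.countable K E) fun α _ => ?_).mono hsub
  by_cases hne : ∃ y₀ : E, ‖y₀‖ = 1 ∧ ψ (ζ * a * y₀ ^ k) = α
  · obtain ⟨y₀, hy₀, hα⟩ := hne
    refine ((finite_zpow_eq hk (y₀ ^ k)).subset ?_).countable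
    rintro y ⟨hy, hyα⟩
    have := hinj _ _ (by simp [hζ, hy]) (by simp [hζ, hy₀]) (hyα.trans hα.symm)
    exact mul_left_cancel₀ (mul_ne_zero hζ0 ha) this
  · convert Set.countable_empty
    exact Set.eq_empty_of_forall_notMem fun y hy => hne ⟨y, hy⟩

end Dependence

/-! ### The contradiction -/

section Main

variable {K E : Type*} [Field K] [Countable K] [NormedField E] [IsUltrametricDist E]
  [IsAlgClosed E] [CharZero E] [Algebra K E] {g : PowerSeries K} {Δ : Set E} {ψ : E → E}
  {k₁ k₂ : ℤ}

theorem RegularEval.false_of_relation (h : RegularEval g Δ ψ) {f : K[X]} (hd : 2 ≤ f.natDegree)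
    (hg : defect f (by omega) g = 0) (hg1 : PowerSeries.constantCoeff g = 1)
    (hunc : ¬ {y : E | ‖y‖ = 1}.Countable) {ζ₁ ζ₂ a : E} (hζ₁ : IsOfFinOrder ζ₁)
    (hζ₂ : IsOfFinOrder ζ₂) (ha : a ∈ Δ) (hat : Transcendental K a) (hk₁ : k₁ ≠ 0) (hk₂ : k₂ ≠ 0)
    (hk : k₁ ≠ k₂) {D₀ : ℕ} (hrel : HasRelation K ψ k₁ k₂ D₀ ζ₁ ζ₂ a) : False := by
  have hd0 : f.natDegree ≠ 0 := by omega
  have hn₁ := hζ₁.norm_eq_one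
  have hn₂ := hζ₂.norm_eq_one
  -- The disc is open, so `|a| ≥ 1` puts a point of norm greater than `1` inside it and `g` is a
  -- polynomial. For `|a| < 1` the powers of `a` tend to `0`.
  rcases le_or_gt 1 ‖a‖ with ha1 | ha1
  · obtain ⟨z, hz, hlt⟩ := h.exists_norm_lt a ha
    obtain ⟨C, hC⟩ := (Bottcher.mem_evalSubring.1 (h.mem_evalSubring z hz)).1.tendsto_atTop_zero.bddAbove_range
    obtain ⟨p, hp⟩ := exists_eq_polynomial_of_one_lt (E := E) hd hg (ha1.trans_lt hlt)
      (fun n => hC ⟨n, rfl⟩)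
    obtain ⟨y, hy, hyt⟩ := Set.not_subset.1 fun hsub =>
      hunc ((countable_isAlgebraic_adjoin (K := K) a).mono hsub)
    obtain ⟨Q, hQ0, -, hvan⟩ := hrel
    exact Bottcher.false_of_relation hat hyt hk₁ hk hζ₁ hζ₂
      (h.isAlgebraic_of_polynomial hg1 hp (h.mem_of_norm_eq_one ha hn₁ hy k₁))
      (h.isAlgebraic_of_polynomial hg1 hp (h.mem_of_norm_eq_one ha hn₂ hy k₂)) hQ0 (hvan y hy)
  · obtain ⟨ε, hε, hsmall⟩ := exists_small_radius (h.ne_zero a ha)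
      (Bottcher.mem_evalSubring.1 (h.mem_evalSubring a ha)).1
    obtain ⟨m, hm⟩ := exists_pow_lt_of_lt_one hε ha1
    set b := a ^ f.natDegree ^ m with hb
    have hbΔ : b ∈ Δ := h.pow_mem ha ha1.le (pow_ne_zero _ hd0)
    have hb1 : ‖b‖ < 1 := by
      rw [hb, norm_pow]
      exact pow_lt_one₀ (norm_nonneg a) ha1 (pow_ne_zero _ hd0)
    have hbε : ‖b‖ < ε := by
      rw [hb, norm_pow]
      exact lt_of_le_of_lt (pow_le_pow_of_le_one (norm_nonneg a) ha1.le
        (Nat.lt_pow_self (by omega)).le) hm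
    have hbt : Transcendental K b := fun hbalg =>
      hat (hbalg.of_pow (Nat.pos_of_ne_zero (pow_ne_zero _ hd0)))
    have hinj : InjOnCircle ψ ‖b‖ := by
      intro u w hu hw huw
      have hmem : ∀ z : E, ‖z‖ = ‖b‖ → z ∈ Δ := fun z hz =>
        h.mem_of_norm_le b hbΔ z (norm_ne_zero_iff.1 (by
          rw [hz]; exact norm_ne_zero_iff.2 (h.ne_zero b hbΔ))) hz.le
      refine injOn_small_circle (p := g.map (algebraMap K E)) (s := ψ u) ?_
        (hsmall ‖b‖ (norm_nonneg b) hbε) hu hw (h.mem_evalSubring u (hmem u hu)) ?_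
      · rw [PowerSeries.coeff_map, PowerSeries.coeff_zero_eq_constantCoeff_apply, hg1, map_one]
      · rw [huw]
        exact h.mem_evalSubring w (hmem w hw)
    obtain ⟨D₁, hrel₁⟩ := h.exists_hasRelation_pow hd0 hg ha ha1.le hn₁ hn₂ hrel m
    rw [← hb] at hrel₁
    set ξ₁ := ζ₁ ^ f.natDegree ^ m
    set ξ₂ := ζ₂ ^ f.natDegree ^ m
    have hξ₁ : IsOfFinOrder ξ₁ := hζ₁.pow
    have hξ₂ : IsOfFinOrder ξ₂ := hζ₂.pow
    have hx₁ := hξ₁.norm_eq_one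
    have hx₂ := hξ₂.norm_eq_one
    have hinf : {y : E | ‖y‖ = 1}.Infinite := fun hfin => hunc hfin.countable
    have hind := h.not_polyIndep hξ₁ hξ₂ hbΔ hb1 hk₁ hk₂ hk hinf hd
      (h.hasRelation_pow_of_injOnCircle hd0 hg hbΔ hb1.le hx₁ hx₂ hk₁ hinj hrel₁)
    have hb0 := h.ne_zero b hbΔ
    -- Besides being transcendental over `K(b)`, `y` must make both values of `ψ` transcendental
    -- over `K`, as `isAlgebraic_of_not_polyIndep` requires. The excluded sets are countable.
    obtain ⟨y, hy, hyt⟩ := Set.not_subset.1 fun hsub =>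
      hunc ((((countable_isAlgebraic_adjoin (K := K) b).union
        (countable_isAlgebraic_value (K := K) hx₁ hb0 hinj hk₁)).union
        (countable_isAlgebraic_value (K := K) hx₂ hb0 hinj hk₂)).mono hsub)
    simp only [Set.mem_union, Set.mem_ofPred_eq, not_or] at hyt hy
    obtain ⟨⟨hyt, h₁⟩, h₂⟩ := hyt
    obtain ⟨Q, hQ0, -, hvan⟩ := hrel₁
    exact Bottcher.false_of_relation hbt hyt hk₁ hk hξ₁ hξ₂
      (h.isAlgebraic_of_not_polyIndep hind (h.mem_of_norm_eq_one hbΔ hx₁ hy k₁)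
        fun hα => h₁ ⟨hy, hα⟩)
      (h.isAlgebraic_of_not_polyIndep hind (h.mem_of_norm_eq_one hbΔ hx₂ hy k₂)
        fun hα => h₂ ⟨hy, hα⟩) hQ0 (hvan y hy)

end Main
end Bottcher

end

theorem theorem4p2 {K : Type*} [Field K] [NumberField K] (v : HeightOneSpectrum (𝓞 K))
    (f : K[X]) (hf : f.Monic) (hd : 2 ≤ f.natDegree)
    (Ψ : LaurentSeries K) (hΨ : Ψ = Bottcher.bottcherInverse f hf hd)
    (P : MvPolynomial (Fin 2) K) (hP0 : P ≠ 0)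
    (hP : Irreducible (MvPolynomial.map (algebraMap K (AlgebraicClosure K)) P))
    (k₁ k₂ : ℤ) (hk : (k₁, k₂) ≠ (0, 0))
    (ζ₁ ζ₂ a : Bottcher.AdicAlgCl K v) (hζ₁ : IsOfFinOrder ζ₁) (hζ₂ : IsOfFinOrder ζ₂)
    (ha : a ∈ Bottcher.puncturedDisc v Ψ) (hat : Transcendental ℚ a)
    (had : ∃ b ∈ Bottcher.puncturedDisc v Ψ, b ^ f.natDegree = a)
    (hvanish : ∀ x : Bottcher.AdicAlgCl K v,
      a * x ^ k₁ ∈ Bottcher.puncturedDisc v Ψ → a * x ^ k₂ ∈ Bottcher.puncturedDisc v Ψ →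
      Bottcher.laurentEval v Ψ (ζ₁ * a * x ^ k₁) ≠ 0 →
      Bottcher.laurentEval v Ψ (ζ₂ * a * x ^ k₂) ≠ 0 →
      MvPolynomial.aeval ![1 / Bottcher.laurentEval v Ψ (ζ₁ * a * x ^ k₁),
        1 / Bottcher.laurentEval v Ψ (ζ₂ * a * x ^ k₂)] P = 0) :
    k₁ * k₂ * (k₁ - k₂) = 0 := by
  by_contra hne
  simp only [mul_eq_zero, not_or, sub_eq_zero] at hne
  obtain ⟨⟨hk₁, hk₂⟩, hk₁₂⟩ := hne
  have := Bottcher.countable_numberField K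
  obtain ⟨g, hg1, hg0, hgc, hgz⟩ := Bottcher.exists_powerSeries_bottcherInverse f hf hd
  rw [← hΨ] at hgc hgz
  have hreg : Bottcher.RegularEval g (Bottcher.puncturedDisc v Ψ) (Bottcher.laurentEval v Ψ) :=
    { ne_zero := fun z hz => hz.1
      mem_of_norm_le := fun z hz z' hz' hle => Bottcher.mem_puncturedDisc_of_norm_le v hz hz' hle
      exists_norm_lt := fun z hz => Bottcher.exists_mem_puncturedDisc_norm_lt v hz
      mem_evalSubring := fun z hz => Bottcher.mem_evalSubring.2 (by
        simp only [PowerSeries.coeff_map]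
        exact ⟨Bottcher.summable_norm_regularPart v hgc hz, Bottcher.hasSum_regularPart v hgc hgz hz⟩) }
  -- `K` is algebraic over `ℚ`.
  have hatK : Transcendental K a := fun halg => hat (halg.restrictScalars ℚ)
  obtain ⟨Q, hQ0, hQ⟩ := Bottcher.exists_reversed_relation (E := Bottcher.AdicAlgCl K v) hP0
  obtain ⟨D, hQD⟩ := Bottcher.exists_mem_restrictDegree Q
  refine hreg.false_of_relation hd hg0 hg1 (Bottcher.not_countable_unit_circle K v) hζ₁ hζ₂ ha hatK
    hk₁ hk₂ hk₁₂ (D₀ := D) ⟨Q, hQ0, hQD, fun y hy => hQ _ _ fun h1 h2 => hvanish y ?_ ?_ h1 h2⟩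
  · have := hreg.mem_of_norm_eq_one ha (norm_one (α := Bottcher.AdicAlgCl K v)) hy k₁
    rwa [one_mul] at this
  · have := hreg.mem_of_norm_eq_one ha (norm_one (α := Bottcher.AdicAlgCl K v)) hy k₂
    rwa [one_mul] at this
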